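/- Let $\mathbb K$ be a rationally additive semiring, i.e. a semiring equipped with a partial operator $\sum$ on at most countable families such that: (1) finite sums exist and are the usual ones; (2) $\sum_{n\ge 0}\alpha^n$ exists for every $\alpha\in\mathbb K$; (3) if $\sum_{i}\alpha_i$ exists, then so do $\sum_i\beta\alpha_i$ and $\sum_i\alpha_i\beta$, with values $\beta(\sum_i\alpha_i)$ and $(\sum_i\alpha_i)\beta$; (4) if $I=\biguplus_{j\in J}I_j$, all $r_j=\sum_{i\in I_j}\alpha_i$ exist and $\sum_{j\in J}r_j$ exists, then $\sum_{i\in I}\alpha_i$ exists and equals $\sum_{j}r_j$; (5) if $I=\biguplus_{j\in J}I_j$, $\sum_{i\in I}\alpha_i$ exists and all $r_j=\sum_{i\in I_j}\alpha_i$ exist, then $\sum_{j}r_j$ exists and equals $\sum_{i\in I}\alpha_i$. Let $M$ be a pre-rational monoid, i.e. for every finite alphabet $A$, every morphism $\mu\colon A^*\to M$ and every $m\in M$ the language $\mu^{-1}(m)$ is rational. Let $s\colon M\to\mathbb K$ be a series. A $\mathbb K$-automaton over $M$ has a finite set of states, sets of initial and of final states, and a finite set of transitions $(p,m,\kappa,q)$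 with label $m\in M$ and weight $\kappa\in\mathbb K$. Its accepting runs are the sequences of consecutive transitions leading from an initial to a final state (the empty sequence is one if some state is both initial and final); labels and weights of runs are products. Its semantics is the series mapping $m$ to the sum of the weights of the accepting runs labelled $m$ (if all these sums exist), and its ambiguity at $m$ is the number in $\mathbb N\cup\{\infty\}$ of accepting runs labelled $m$. $\mathbb K$-expressions over $M$ are $W::=\kappa\mid m\mid W+W\mid W\cdot W\mid W^*$ with $\kappa\in\mathbb K$, $m\in M$. Their semantics is given by: $\kappa$ at $\epsilon_M$ and $0$ elsewhere; the characteristic series of $m$; the pointwise sum; the Cauchy product $[\![U\cdot V]\!](m)=\sum_{m_1m_2=m}[\![U]\!](m_1)[\![V]\!](m_2)$; $[\![U^*]\!](m)=\sum_{n\ge0}[\![U^n]\!](m)$ with $U^0=1$, $U^{n+1}=U\cdot U^n$ (if all these sums exist; a sum over an index set of any size means the sum over a countable subset containing its support). The ambiguity of $W$ at $m$ is the value in the counting semiring $\mathbb N\cup\{\infty\}$ given by the same formulas with every atomic weight $\kappa$ (including $\kappa=0$) replaced by $1$; in that semiring infinitely many non-zero terms sum to $\infty$. Then: 1. For every integer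 $k\ge1$, $s$ is the semantics of a $\mathbb K$-automaton over $M$ whose ambiguity is at most $k$ at every point if and only if $s$ is the semantics of a $\mathbb K$-expression over $M$ whose ambiguity is at most $k$ at every point. 2. The same equivalence holds for every integer $k\ge1$ with "the supremum of the ambiguity over all points is exactly $k$" in place of "the ambiguity is at most $k$ at every point". 3. Ambiguity is preserved pointwise. If $s$ is the semantics of a $\mathbb K$-automaton having at least one accepting run, then $s$ is the semantics of a $\mathbb K$-expression with the same ambiguity as the automaton at every point of $M$. If $s$ is the semantics of a $\mathbb K$-expression, then $s$ is the semantics of a $\mathbb K$-automaton that has at least one accepting run and the same ambiguity as the expression at every point of $M$. -/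

import Mathlib

universe u v w

/-- A monoid `M` is pre-rational if for every finite alphabet `A`, every morphism `A* → M` and every
`m : M`, the preimage of `m` is a rational (i.e. regular) language over `A`. -/
def IsPreRational (M : Type v) [Monoid M] : Prop :=
  ∀ (A : Type) [Finite A] (μ : FreeMonoid A →* M) (m : M),
    Language.IsRegular ({x : List A | μ (FreeMonoid.ofList x) = m} : Language A)

/-- A rationally additive semiring: a semiring equipped with a partial operator `csum` defining the
sums of some countable families. A disjoint union `I = ⨆ j, I j` is given by the map `p : I → J`
with `I j = p ⁻¹' {j}`. `a ∈ csum f` means that the sum of `f` exists and is equal to `a`. -/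
class RationallyAdditive (K : Type u) [Semiring K] where
  csum : {I : Type} → [Countable I] → (I → K) → Part K
  sum_fintype : ∀ {I : Type} [Fintype I] (f : I → K), ∑ i, f i ∈ csum f
  geom_exists : ∀ a : K, (csum (fun n : ℕ => a ^ n)).Dom
  mul_left : ∀ {I : Type} [Countable I] (f : I → K) (a b : K),
    a ∈ csum f → b * a ∈ csum (fun i => b * f i)
  mul_right : ∀ {I : Type} [Countable I] (f : I → K) (a b : K),
    a ∈ csum f → a * b ∈ csum (fun i => f i * b)
  sum_of_parts : ∀ {I J : Type} [Countable I] [Countable J] (p : I → J) (f : I → K) (r : J → K)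
    (a : K), (∀ j, r j ∈ csum (fun i : {i : I // p i = j} => f i)) → a ∈ csum r → a ∈ csum f
  parts_of_sum : ∀ {I J : Type} [Countable I] [Countable J] (p : I → J) (f : I → K) (r : J → K)
    (a : K), a ∈ csum f → (∀ j, r j ∈ csum (fun i : {i : I // p i = j} => f i)) → a ∈ csum r

section Sums

variable {K : Type u} [Semiring K] [RationallyAdditive K]

/-- The sum of the family `f`, over an index type of any size and in any universe, exists and is
equal to `a`: some countable set of indices (enumerated by `e`) contains the support of `f`, and the
sum of `f` over it exists and is `a`. For countable `ι : Type` this is `a ∈ csum f`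
(`hasCSum_iff` below). -/
def HasCSum {ι : Type w} (f : ι → K) (a : K) : Prop :=
  ∃ (I : Type) (_ : Countable I) (e : I → ι), Function.Injective e ∧
    Function.support f ⊆ Set.range e ∧ a ∈ RationallyAdditive.csum (fun i => f (e i))

namespace RationallyAdditive

theorem csum_zero (J : Type) [Countable J] : (0 : K) ∈ csum (fun _ : J => (0 : K)) := by
  have h : (0 : K) ∈ csum (fun _ : ℕ => (0 : K)) := by
    have := mul_left _ _ 0 (Part.get_mem (geom_exists (0 : K)))
    simpa using this
  obtain ⟨g, hg⟩ := exists_injective_nat J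
  refine sum_of_parts g _ (fun _ => 0) 0 (fun n => ?_) h
  have : Subsingleton {i : J // g i = n} :=
    ⟨fun x y => Subtype.ext (hg (x.2.trans y.2.symm))⟩
  have := Fintype.ofFinite {i : J // g i = n}
  have := sum_fintype (fun _ : {i : J // g i = n} => (0 : K))
  simpa using this

theorem csum_single {X : Type} [Countable X] (g : X → K) (x : X) (h : ∀ y, y ≠ x → g y = 0) :
    g x ∈ csum g := by
  classical
  have hs := sum_fintype (fun b : Bool => if b then g x else 0)
  have he : (∑ b : Bool, if b then g x else (0 : K)) = g x := by simp
  rw [he] at hs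
  refine sum_of_parts (fun y => decide (y = x)) g _ _ (fun b => ?_) hs
  cases b
  · have : (fun i : {i : X // decide (i = x) = false} => g i) = fun _ => 0 := by
      funext i
      exact h _ (by simpa using i.2)
    rw [this]
    exact csum_zero _
  · let _ : Unique {i : X // decide (i = x) = true} :=
      ⟨⟨⟨x, by simp⟩⟩, fun y => Subtype.ext (by simpa using y.2)⟩
    have := sum_fintype (fun i : {i : X // decide (i = x) = true} => g i)
    rw [Fintype.sum_unique] at this
    exact this

end RationallyAdditive

open RationallyAdditive in
/-- On countable families the extended sum is the given partial operator. -/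
theorem hasCSum_iff {ι : Type} [Countable ι] (f : ι → K) (a : K) :
    HasCSum f a ↔ a ∈ csum f := by
  refine ⟨?_, fun h => ⟨ι, inferInstance, id, Function.injective_id, by simp, h⟩⟩
  rintro ⟨I, hI, e, he, hs, ha⟩
  have hz : ∀ i, i ∉ Set.range e → f i = 0 := fun i hi => by
    by_contra h
    exact hi (hs h)
  rcases isEmpty_or_nonempty I with hE | hE
  · have h0 : f = fun _ => 0 := by
      funext i
      exact hz i (fun ⟨j, _⟩ => hE.elim j)
    have := Fintype.ofFinite I
    have h1 := sum_fintype (fun i : I => f (e i))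
    rw [Fintype.sum_empty] at h1
    rw [Part.mem_unique ha h1, h0]
    exact csum_zero _
  · refine sum_of_parts (Function.invFun e) f _ _ (fun j => ?_) ha
    refine csum_single (fun i : {i : ι // Function.invFun e i = j} => f i)
      ⟨e j, Function.leftInverse_invFun he j⟩ (fun y hy => hz _ ?_)
    rintro ⟨k, hk⟩
    refine hy (Subtype.ext ?_)
    have := y.2
    rw [← hk, Function.leftInverse_invFun he k] at this
    rw [← hk, this]

end Sums

open Classical in
/-- Summation in the counting semiring `ℕ ∪ {∞}`: infinitely many non-zero values sum to `∞`,
otherwise the sum is the finite sum over the support. -/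
noncomputable def countSum {ι : Type w} (f : ι → ℕ∞) : ℕ∞ :=
  if (Function.support f).Finite then ∑ᶠ i, f i else ⊤

/-- `K`-expressions over `M`: `W ::= k | m | W + W | W · W | W*`. -/
inductive WExpr (K : Type u) (M : Type v) : Type (max u v)
  | scalar (k : K) : WExpr K M
  | elem (m : M) : WExpr K M
  | add (U V : WExpr K M) : WExpr K M
  | mul (U V : WExpr K M) : WExpr K M
  | star (U : WExpr K M) : WExpr K M

namespace WExpr

variable {K : Type u} {M : Type v} [Monoid M]

open Classical in
/-- `W.HasSem s`: the expression `W` is valid and its semantics is the series `s`. In the case of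
the star, `t n` is the semantics of `U ^ n`, where `U ^ 0 = 1` and `U ^ (n + 1) = U · U ^ n`. -/
def HasSem [Semiring K] [RationallyAdditive K] : WExpr K M → (M → K) → Prop
  | scalar k, s => s = fun x => if x = 1 then k else 0
  | elem m, s => s = fun x => if x = m then 1 else 0
  | add U V, s => ∃ a b, U.HasSem a ∧ V.HasSem b ∧ s = a + b
  | mul U V, s => ∃ a b, U.HasSem a ∧ V.HasSem b ∧
      ∀ m, HasCSum (fun q : {q : M × M // q.1 * q.2 = m} => a q.1.1 * b q.1.2) (s m)
  | star U, s => ∃ a, U.HasSem a ∧ ∃ t : ℕ → M → K,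
      (t 0 = fun x => if x = 1 then 1 else 0) ∧
      (∀ n m, HasCSum (fun q : {q : M × M // q.1 * q.2 = m} => a q.1.1 * t n q.1.2) (t (n + 1) m)) ∧
      ∀ m, HasCSum (fun n => t n m) (s m)

/-- Cauchy product of two `ℕ ∪ {∞}`-series. -/
noncomputable def countMul (a b : M → ℕ∞) (m : M) : ℕ∞ :=
  countSum fun q : {q : M × M // q.1 * q.2 = m} => a q.1.1 * b q.1.2

open Classical in
/-- The ambiguity `W.amb m` of the expression `W` at `m`; in the case of the star, the `n`-th
iterate is the ambiguity of `U ^ n`, where `U ^ 0 = 1` and `U ^ (n + 1) = U · U ^ n`. -/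
noncomputable def amb : WExpr K M → M → ℕ∞
  | scalar _ => fun x => if x = 1 then 1 else 0
  | elem m => fun x => if x = m then 1 else 0
  | add U V => fun x => U.amb x + V.amb x
  | mul U V => countMul U.amb V.amb
  | star U => fun x => countSum fun n : ℕ =>
      (countMul U.amb)^[n] (fun y => if y = 1 then 1 else 0) x

end WExpr

/-- A transition `(src, label, weight, tgt)`. -/
structure WTransition (K : Type u) (M : Type v) (Q : Type) where
  src : Q
  label : M
  weight : K
  tgt : Q

/-- A `K`-automaton over `M`: finitely many states, a finite set of transitions. -/
structure WAutomaton (K : Type u) (M : Type v) where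
  Q : Type
  finite_states : Finite Q
  init : Set Q
  trans : Set (WTransition K M Q)
  finite_trans : trans.Finite
  final : Set Q

namespace WAutomaton

variable {K : Type u} {M : Type v}

/-- The word `w` of transitions is a run from `p` to `q`. -/
def IsPath (A : WAutomaton K M) : A.Q → List (WTransition K M A.Q) → A.Q → Prop
  | p, [], q => p = q
  | p, t :: w, q => t ∈ A.trans ∧ t.src = p ∧ A.IsPath t.tgt w q

/-- The accepting runs, as a language over the transitions. -/
def acceptingRuns (A : WAutomaton K M) : Set (List (WTransition K M A.Q)) :=
  {w | ∃ p ∈ A.init, ∃ q ∈ A.final, A.IsPath p w q}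

/-- The accepting runs with label `m`. -/
def acceptingRunsOn [Monoid M] (A : WAutomaton K M) (m : M) : Set (List (WTransition K M A.Q)) :=
  {w | w ∈ A.acceptingRuns ∧ (w.map WTransition.label).prod = m}

/-- `A.HasSem s`: the automaton `A` is valid and its semantics is the series `s`. -/
def HasSem [Monoid M] [Semiring K] [RationallyAdditive K] (A : WAutomaton K M) (s : M → K) : Prop :=
  ∀ m, HasCSum (fun w : A.acceptingRunsOn m => (w.1.map WTransition.weight).prod) (s m)

/-- The ambiguity of `A` at `m`: the number, possibly `∞`, of accepting runs with label `m`. -/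
noncomputable def amb [Monoid M] (A : WAutomaton K M) (m : M) : ℕ∞ :=
  (A.acceptingRunsOn m).encard

end WAutomaton

/-!
Everything is reduced to languages of words over a finite alphabet whose letters carry a label in
`M` and a weight in `K`. An expression `W` *represents* such a language `X`
(`WExpr.Represents`) if its ambiguity at `m` counts the words of `X` with label `m`, and if its
semantics at `m` is the sum of their weights. The accepting runs of an automaton are in a bijection
with the words of a regular language that preserves labels and weights, and conversely
(`WAutomaton.exists_isRegular_isEncoding`, `WAutomaton.isEncoding_ofDFA`). So the theorem says that
nonempty regular languages and expressions represent the same data.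

The sums over the languages that occur exist for the following reason. A regular language is denoted
by an unambiguous rational expression (`Language.IsRegular.unambRat`): in the recursion of
McNaughton and Yamada for a deterministic automaton, all unions are disjoint, and all products and
stars are unambiguous because the words leading to a state `r` without visiting it earlier form a
prefix-free language. Evaluating such an expression in `K`, where the star becomes a geometric
series, shows that the sum of the weights over any regular language exists
(`LangSum.exists_of_isRegular`). Since `M` is pre-rational, the words of a regular language with a
given label again form a regular language, so these sums exist as well.

For an unambiguous sum, product or star of languages, the words with label `m` are partitioned by
the labels of their factors, or by the number of factors. As all the partial sums exist, the two
axioms on partitions identify the sum over all these words with the nested sum in the semantics of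
expressions (`HasCSum.fiber_iff`, `LangSum.partition_iff`), and the number of these words is given
by the nested sum in `ℕ ∪ {∞}` (`countSum_encard`). Hence `Represents` is compatible with all three
operations.

From an automaton, a representing expression is then obtained by induction on an unambiguous
rational expression for its runs; only the empty language has none, which is why an accepting run
is needed. From an expression, a represented language is obtained by induction: disjoint alphabets
and an end marker make all the operations unambiguous (`WExpr.hasRegularCode`).
-/

/-! ### Extended sums -/

/-- A sum may be restricted to any subset of the index type that contains the support. -/
theorem RationallyAdditive.csum_subtype {K : Type u} [Semiring K] [RationallyAdditive K] {I : Type}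
    [Countable I] {f : I → K} {a : K} (S : Set I) (hS : ∀ i, i ∉ S → f i = 0) (ha : a ∈ csum f) :
    a ∈ csum (fun i : S => f i) := by
  classical
  rcases S.eq_empty_or_nonempty with rfl | ⟨s, hs⟩
  · have h0 : f = fun _ => 0 := funext fun i => hS i (Set.notMem_empty i)
    have ha0 : a = 0 := Part.mem_unique ha (h0 ▸ csum_zero I)
    have h := sum_fintype (fun i : (∅ : Set I) => f i)
    rwa [Fintype.sum_empty, ← ha0] at h
  · -- all indices outside `S` are sent to the part of the fixed index `s`
    refine parts_of_sum (fun i => if h : i ∈ S then (⟨i, h⟩ : S) else ⟨s, hs⟩) f _ a ha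
      fun j => ?_
    refine csum_single (fun i : {i : I // (if h : i ∈ S then (⟨i, h⟩ : S) else ⟨s, hs⟩) = j} => f i)
      ⟨j, by simp⟩ ?_
    rintro ⟨i, hi⟩ hne
    refine hS i fun hiS => hne (Subtype.ext ?_)
    rw [dif_pos hiS] at hi
    subst hi
    rfl

namespace HasCSum

variable {K : Type u} [Semiring K] [RationallyAdditive K]

open RationallyAdditive

/-- A sum may be reindexed along an injection whose range contains the support. -/
theorem comp_iff {ι : Type v} {κ : Type w} {f : ι → K} {a : K} (g : κ → ι)
    (hg : Function.Injective g) (hs : Function.support f ⊆ Set.range g) :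
    HasCSum (fun k => f (g k)) a ↔ HasCSum f a := by
  constructor
  · rintro ⟨I, hI, e, he, hsup, ha⟩
    refine ⟨I, hI, g ∘ e, hg.comp he, fun i hi => ?_, ha⟩
    obtain ⟨k, rfl⟩ := hs hi
    obtain ⟨j, rfl⟩ := hsup (show k ∈ Function.support fun k => f (g k) from hi)
    exact ⟨j, rfl⟩
  · rintro ⟨I, hI, e, he, hsup, ha⟩
    have hch : ∀ i : {i : I // e i ∈ Set.range g}, g i.2.choose = e i := fun i => i.2.choose_spec
    refine ⟨{i : I // e i ∈ Set.range g}, inferInstance, fun i => i.2.choose, ?_, ?_, ?_⟩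
    · intro i j hij
      have h : g i.2.choose = g j.2.choose := congrArg g hij
      rw [hch, hch] at h
      exact Subtype.ext (he h)
    · intro k hk
      obtain ⟨i, hi⟩ := hsup (show g k ∈ Function.support f from hk)
      exact ⟨⟨i, k, hi.symm⟩, hg ((hch _).trans hi)⟩
    · have h := csum_subtype {i | e i ∈ Set.range g} (fun i hi => by
        by_contra h0
        exact hi (hs h0)) ha
      have hfun : (fun i : {i : I // e i ∈ Set.range g} => f (g i.2.choose))
          = fun i => f (e i.1) := funext fun i => congrArg f (hch i)
      rw [hfun]
      exact h

theorem unique {ι : Type v} {f : ι → K} {a b : K} (ha : HasCSum f a) (hb : HasCSum f b) :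
    a = b := by
  obtain ⟨I, hI, e, he, hsup, hcs⟩ := ha
  rw [← comp_iff e he hsup, hasCSum_iff] at hb
  exact Part.mem_unique hcs hb

theorem zero {ι : Type v} {f : ι → K} (h : ∀ i, f i = 0) : HasCSum f 0 := by
  refine ⟨Empty, inferInstance, Empty.elim, fun x => x.elim, fun i hi => (hi (h i)).elim, ?_⟩
  have := sum_fintype (fun i : Empty => f i.elim)
  rwa [Fintype.sum_empty] at this

theorem eq_single {ι : Type v} {f : ι → K} (i : ι) (h : ∀ j, j ≠ i → f j = 0) :
    HasCSum f (f i) := by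
  refine ⟨Unit, inferInstance, fun _ => i, fun _ _ _ => rfl, fun j hj => ⟨(), ?_⟩, ?_⟩
  · by_contra hne
    exact hj (h j (Ne.symm hne))
  · have := sum_fintype (fun _ : Unit => f i)
    rwa [Fintype.sum_unique] at this

theorem mul_left {ι : Type v} {f : ι → K} {a : K} (b : K) (h : HasCSum f a) :
    HasCSum (fun i => b * f i) (b * a) := by
  obtain ⟨I, hI, e, he, hsup, ha⟩ := h
  refine ⟨I, hI, e, he, fun i hi => hsup fun h0 => hi ?_, RationallyAdditive.mul_left _ _ _ ha⟩
  simp [h0]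

theorem mul_right {ι : Type v} {f : ι → K} {a : K} (b : K) (h : HasCSum f a) :
    HasCSum (fun i => f i * b) (a * b) := by
  obtain ⟨I, hI, e, he, hsup, ha⟩ := h
  refine ⟨I, hI, e, he, fun i hi => hsup fun h0 => hi ?_, RationallyAdditive.mul_right _ _ _ ha⟩
  simp [h0]

/-- Summation by parts: if the sums over all fibres of `p` exist, then the family is summable if and
only if the family of the partial sums is, with the same sum. The index type of the parts may be
uncountable, but only countably many parts are nonempty. -/
theorem fiber_iff {ι : Type} [Countable ι] {κ : Type w} {f : ι → K} {r : κ → K} {a : K}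
    (p : ι → κ) (hr : ∀ j, HasCSum (fun i : {i : ι // p i = j} => f i) (r j)) :
    HasCSum f a ↔ HasCSum r a := by
  -- the nonempty parts are indexed by a countable type in the lowest universe
  let J := Quotient (Setoid.ker p)
  let g : J → κ := Quotient.lift p fun _ _ h => h
  have hg : Function.Injective g := by
    rintro ⟨x⟩ ⟨y⟩ h
    exact Quotient.sound h
  have hsup : Function.support r ⊆ Set.range g := by
    intro j hj
    by_contra hne
    refine hj ((hr j).unique (zero ?_))
    rintro ⟨i, hi⟩
    exact (hne ⟨Quotient.mk _ i, hi⟩).elim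
  have hparts : ∀ j : J, r (g j) ∈ csum
      (fun i : {i : ι // (Quotient.mk _ i : J) = j} => f i) := by
    intro j
    rw [← hasCSum_iff]
    have key : ∀ i : {i : ι // p i = g j}, (Quotient.mk _ i.1 : J) = j := fun i => hg i.2
    rw [← comp_iff (fun i : {i : ι // p i = g j} =>
        (⟨i.1, key i⟩ : {i : ι // (Quotient.mk _ i : J) = j}))
      (fun x y h => Subtype.ext (congrArg (fun z => z.1) h))
      (fun i _ => ⟨⟨i.1, congrArg g i.2⟩, rfl⟩)]
    exact hr (g j)
  rw [← comp_iff g hg hsup, hasCSum_iff, hasCSum_iff]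
  exact ⟨fun h => parts_of_sum _ f _ a h hparts, fun h => sum_of_parts _ f _ a hparts h⟩

end HasCSum

/-! ### Sums over languages -/

/-- The sum over the language `X` of the weights of the words exists and equals `a`, where the
weight of a word is the product of the weights of its letters. -/
def LangSum {K : Type u} [Semiring K] [RationallyAdditive K] {α : Type} (wt : α → K)
    (X : Language α) (a : K) : Prop :=
  HasCSum (fun x : {x : List α // x ∈ X} => (x.1.map wt).prod) a

namespace LangSum

variable {K : Type u} [Semiring K] [RationallyAdditive K] {α : Type} {wt : α → K}

theorem unique {X : Language α} {a b : K} (ha : LangSum wt X a) (hb : LangSum wt X b) : a = b :=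
  HasCSum.unique ha hb

theorem zero : LangSum wt (0 : Language α) 0 :=
  HasCSum.zero fun x => (Language.notMem_zero _ x.2).elim

theorem singleton {X : Language α} (y : List α) (h : ∀ x, x ∈ X ↔ x = y) :
    LangSum wt X (y.map wt).prod :=
  HasCSum.eq_single (f := fun x : {x : List α // x ∈ X} => (x.1.map wt).prod) ⟨y, (h y).2 rfl⟩
    fun j hj => (hj (Subtype.ext ((h j).1 j.2))).elim

/-- A weight-preserving injection of words transports sums over languages. -/
theorem image_iff {β : Type} {wt' : β → K} {X : Language α} {Y : Language β} {a : K}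
    (φ : List α → List β) (hφ : ∀ x ∈ X, ∀ y ∈ X, φ x = φ y → x = y)
    (hY : ∀ y, y ∈ Y ↔ ∃ x ∈ X, φ x = y)
    (hw : ∀ x ∈ X, ((φ x).map wt').prod = (x.map wt).prod) :
    LangSum wt' Y a ↔ LangSum wt X a := by
  have h := HasCSum.comp_iff (f := fun y : {y // y ∈ Y} => (y.1.map wt').prod) (a := a)
    (fun x : {x // x ∈ X} => ⟨φ x.1, (hY _).2 ⟨x.1, x.2, rfl⟩⟩)
    (fun x y hxy => Subtype.ext (hφ _ x.2 _ y.2 (congrArg Subtype.val hxy)))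
    (fun y _ => by
      obtain ⟨x, hx, he⟩ := (hY y.1).1 y.2
      exact ⟨⟨x, hx⟩, Subtype.ext he⟩)
  unfold LangSum
  rw [← h]
  have : (fun x : {x // x ∈ X} => ((φ x.1).map wt').prod) = fun x => (x.1.map wt).prod :=
    funext fun x => hw _ x.2
  rw [this]

/-- If the sums over the parts of a partition of `Z` exist, then the sum over `Z` is the sum of the
sums over the parts. The index type of the parts may be uncountable. -/
theorem partition_iff [Countable α] {κ : Type w} {Z : Language α} {P : κ → Language α} {r : κ → K}
    {c : K} (hmem : ∀ x, x ∈ Z ↔ ∃ j, x ∈ P j) (hdis : ∀ x i j, x ∈ P i → x ∈ P j → i = j)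
    (hr : ∀ j, LangSum wt (P j) (r j)) : LangSum wt Z c ↔ HasCSum r c := by
  have hch : ∀ z : {z // z ∈ Z}, z.1 ∈ P ((hmem z.1).1 z.2).choose :=
    fun z => ((hmem z.1).1 z.2).choose_spec
  refine HasCSum.fiber_iff (fun z : {z // z ∈ Z} => ((hmem z.1).1 z.2).choose) fun j => ?_
  rw [← HasCSum.comp_iff (fun x : {x // x ∈ P j} =>
    (⟨⟨x.1, (hmem _).2 ⟨j, x.2⟩⟩, hdis _ _ _ (hch _) x.2⟩ :
      {z : {z // z ∈ Z} // ((hmem z.1).1 z.2).choose = j}))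
    (fun x y h => Subtype.ext (congrArg (fun z => z.1.1) h))
    (fun z _ => ⟨⟨z.1.1, by have h := hch z.1; rwa [z.2] at h⟩, rfl⟩)]
  exact hr j

theorem add [Countable α] {X Y : Language α} {a b : K} (hXY : ∀ x ∈ X, x ∉ Y)
    (ha : LangSum wt X a) (hb : LangSum wt Y b) : LangSum wt (X + Y) (a + b) := by
  rw [partition_iff (P := fun i : Bool => if i then X else Y) (r := fun i => if i then a else b)
    (c := a + b) (fun x => by simp [Language.mem_add, or_comm])
    (fun x i j hi hj => by
      cases i <;> cases j <;> simp only [if_true, if_false, Bool.false_eq_true] at hi hj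
      exacts [rfl, (hXY x hj hi).elim, (hXY x hi hj).elim, rfl])
    (fun j => by cases j <;> simpa), hasCSum_iff]
  simpa using RationallyAdditive.sum_fintype (fun i : Bool => if i then a else b)

end LangSum

/-! ### Counting -/

/-- Summation in the counting semiring is compatible with counting the elements of a partition. -/
theorem countSum_encard {κ : Type w} {β : Type v} {Z : Set β} {P : κ → Set β}
    (hmem : ∀ x, x ∈ Z ↔ ∃ j, x ∈ P j) (hdis : ∀ x i j, x ∈ P i → x ∈ P j → i = j) :
    countSum (fun j => (P j).encard) = Z.encard := by
  have hsupp : ∀ j, j ∈ Function.support (fun j => (P j).encard) ↔ (P j).Nonempty := fun j => by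
    simp [Set.nonempty_iff_ne_empty]
  unfold countSum
  split_ifs with h
  · have hZ : Z = ⋃ j ∈ Function.support (fun j => (P j).encard), P j := by
      ext x
      simp only [hmem, Set.mem_iUnion, hsupp, exists_prop]
      exact ⟨fun ⟨j, hj⟩ => ⟨j, ⟨x, hj⟩, hj⟩, fun ⟨j, _, hj⟩ => ⟨j, hj⟩⟩
    rw [hZ, h.encard_biUnion, finsum_mem_support]
    intro i _ j _ hij
    exact Set.disjoint_left.2 fun x hi hj => hij (hdis x i j hi hj)
  · have hch : ∀ j : Function.support (fun j => (P j).encard), ((hsupp j).1 j.2).choose ∈ P j :=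
      fun j => ((hsupp j).1 j.2).choose_spec
    refine (Set.encard_eq_top_iff.2 fun hfin => h ?_).symm
    have := hfin.to_subtype
    have hinj : Function.Injective fun j : Function.support (fun j => (P j).encard) =>
        (⟨_, (hmem _).2 ⟨j.1, hch j⟩⟩ : Z) := fun i j hij => by
      have h1 : ((hsupp i).1 i.2).choose = ((hsupp j).1 j.2).choose := congrArg Subtype.val hij
      exact Subtype.ext (hdis _ _ _ (hch i) (h1 ▸ hch j))
    exact @Set.toFinite _ _ (Finite.of_injective _ hinj)

open Computability

namespace Language

variable {α : Type}

/-! ### Closure properties of regular languages -/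

/-- A language with finitely many left quotients is regular, and it suffices to enclose the
left quotients in a finite set. -/
theorem isRegular_of_leftQuotient_mem {X : Language α} {S : Set (Language α)} (hS : S.Finite)
    (h : ∀ x, X.leftQuotient x ∈ S) : X.IsRegular :=
  .of_finite_range_leftQuotient (hS.subset (Set.range_subset_iff.2 h))

theorem isRegular_zero : (0 : Language α).IsRegular :=
  isRegular_of_leftQuotient_mem (Set.finite_singleton 0) fun _ => rfl

theorem isRegular_one : (1 : Language α).IsRegular := by
  refine isRegular_of_leftQuotient_mem (S := {0, 1}) (Set.toFinite _) fun x => ?_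
  rcases x with _ | ⟨a, x⟩
  · exact Or.inr rfl
  · refine Or.inl (Language.ext fun y => ?_)
    simp [mem_leftQuotient, mem_one]

theorem isRegular_letter (a : α) : ({[a]} : Language α).IsRegular := by
  refine isRegular_of_leftQuotient_mem (S := {0, 1, {[a]}}) (Set.toFinite _) fun x => ?_
  have hm : ∀ y : List α, y ∈ ({[a]} : Language α) ↔ y = [a] := fun y => Iff.rfl
  rcases x with _ | ⟨b, _ | ⟨c, x⟩⟩
  · exact Or.inr (Or.inr rfl)
  · by_cases hab : b = a
    · refine Or.inr (Or.inl (Language.ext fun y => ?_))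
      simp [mem_leftQuotient, hm, hab, mem_one]
    · refine Or.inl (Language.ext fun y => ?_)
      simp [mem_leftQuotient, hm, hab]
  · refine Or.inl (Language.ext fun y => ?_)
    simp [mem_leftQuotient, hm]

/-- A left quotient of `X * Y` is the union of `Q * Y` and of some left quotients of `Y`, where
`Q` is a left quotient of `X`. -/
theorem IsRegular.mul {X Y : Language α} (hX : X.IsRegular) (hY : Y.IsRegular) :
    (X * Y).IsRegular := by
  refine isRegular_of_leftQuotient_mem
    (S := Set.image2 (fun Q S => (Q * Y + ⨆ R ∈ S, R : Language α))
      (Set.range X.leftQuotient) (𝒫 (Set.range Y.leftQuotient)))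
    (hX.finite_range_leftQuotient.image2 _ hY.finite_range_leftQuotient.finite_subsets) fun x => ?_
  refine ⟨_, ⟨x, rfl⟩, {R | ∃ u v, u ++ v = x ∧ u ∈ X ∧ R = Y.leftQuotient v}, ?_, ?_⟩
  · rintro _ ⟨u, v, -, -, rfl⟩
    exact ⟨v, rfl⟩
  · ext y
    simp only [mem_add, mem_mul, mem_leftQuotient, mem_iSup, exists_prop]
    constructor
    · rintro (⟨q, hq, b, hb, rfl⟩ | ⟨_, ⟨u, v, rfl, hu, rfl⟩, hy⟩)
      · exact ⟨x ++ q, hq, b, hb, List.append_assoc ..⟩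
      · exact ⟨u, hu, v ++ y, hy, (List.append_assoc ..).symm⟩
    · rintro ⟨a, ha, b, hb, he⟩
      rcases List.append_eq_append_iff.1 he with ⟨c, rfl, rfl⟩ | ⟨c, rfl, rfl⟩
      · exact Or.inr ⟨_, ⟨a, c, rfl, ha, rfl⟩, hb⟩
      · exact Or.inl ⟨c, ha, b, hb, rfl⟩

/-- If `x` is a nonempty prefix of a word of `X∗`, then the end of `x` is cut within a factor or at
the end of a factor, in which case the whole of that factor is taken as `v`. -/
theorem append_mem_kstar_iff {X : Language α} {x y : List α} (hx : x ≠ []) :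
    x ++ y ∈ X∗ ↔ ∃ u v, u ++ v = x ∧ u ∈ X∗ ∧ y ∈ X.leftQuotient v * X∗ := by
  have hmul : ∀ {a b : List α}, a ∈ X → b ∈ X∗ → a ++ b ∈ X∗ := fun ha hb => by
    rw [← one_add_self_mul_kstar_eq_kstar]
    exact Or.inr (append_mem_mul ha hb)
  constructor
  · rintro ⟨L, hL, hmem⟩
    induction L generalizing x with
    | nil => exact (hx (List.append_eq_nil_iff.1 hL).1).elim
    | cons l L ih =>
      have hl := hmem l List.mem_cons_self
      have hmem' : ∀ z ∈ L, z ∈ X := fun z hz => hmem z (List.mem_cons_of_mem _ hz)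
      rw [List.flatten_cons] at hL
      rcases List.append_eq_append_iff.1 hL with ⟨c, rfl, rfl⟩ | ⟨c, rfl, hc⟩
      · exact ⟨[], x, rfl, nil_mem_kstar X, append_mem_mul hl (join_mem_kstar hmem')⟩
      · rcases eq_or_ne c [] with rfl | hne
        · refine ⟨[], l ++ [], rfl, nil_mem_kstar X, ?_⟩
          have : y = [] ++ L.flatten := by simpa using hc.symm
          rw [this]
          exact append_mem_mul (by simpa [mem_leftQuotient]) (join_mem_kstar hmem')
        · obtain ⟨u, v, rfl, hu, hy⟩ := ih hne hc.symm hmem'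
          exact ⟨l ++ u, v, List.append_assoc .., hmul hl hu, hy⟩
  · rintro ⟨u, v, rfl, ⟨L, rfl, hL⟩, q, hq, r, ⟨R, rfl, hR⟩, rfl⟩
    refine ⟨L ++ (v ++ q) :: R, by simp, fun z hz => ?_⟩
    rcases List.mem_append.1 hz with h | h
    · exact hL z h
    · rcases List.mem_cons.1 h with rfl | h
      · exact hq
      · exact hR z h

theorem IsRegular.kstar {X : Language α} (hX : X.IsRegular) : X∗.IsRegular := by
  refine isRegular_of_leftQuotient_mem
    (S := insert X∗ ((fun S : Set (Language α) => (⨆ R ∈ S, R * X∗ : Language α)) ''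
      (𝒫 (Set.range X.leftQuotient))))
    ((hX.finite_range_leftQuotient.finite_subsets.image _).insert _) fun x => ?_
  rcases eq_or_ne x [] with rfl | hx
  · exact Or.inl rfl
  · refine Or.inr ⟨{R | ∃ u v, u ++ v = x ∧ u ∈ X∗ ∧ R = X.leftQuotient v}, ?_, ?_⟩
    · rintro _ ⟨u, v, -, -, rfl⟩
      exact ⟨v, rfl⟩
    · ext y
      simp only [mem_leftQuotient, append_mem_kstar_iff hx, mem_iSup, exists_prop]
      exact ⟨fun ⟨_, ⟨u, v, h, hu, e⟩, hy⟩ => ⟨u, v, h, hu, e ▸ hy⟩,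
        fun ⟨u, v, h, hu, hy⟩ => ⟨_, ⟨u, v, h, hu, rfl⟩, hy⟩⟩

theorem IsRegular.pow {X : Language α} (hX : X.IsRegular) (n : ℕ) : (X ^ n).IsRegular := by
  induction n with
  | zero => exact isRegular_one
  | succ n ih => exact pow_succ' X n ▸ hX.mul ih

theorem mem_map_iff {β : Type} (f : α → β) (X : Language α) (y : List β) :
    y ∈ Language.map f X ↔ ∃ x ∈ X, x.map f = y := Iff.rfl

theorem IsRegular.map {β : Type} {X : Language α} (hX : X.IsRegular) {f : α → β}
    (hf : Function.Injective f) : (Language.map f X).IsRegular := by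
  refine isRegular_of_leftQuotient_mem
    (S := insert 0 (Language.map f '' (Set.range X.leftQuotient)))
    ((hX.finite_range_leftQuotient.image _).insert _) fun x => ?_
  by_cases hx : ∃ x' : List α, x'.map f = x
  · obtain ⟨x, rfl⟩ := hx
    refine Or.inr ⟨_, ⟨x, rfl⟩, Language.ext fun y => ?_⟩
    rw [mem_leftQuotient, mem_map_iff, mem_map_iff]
    constructor
    · rintro ⟨z, hz, rfl⟩
      exact ⟨x ++ z, hz, List.map_append ..⟩
    · rintro ⟨z, hz, he⟩
      obtain ⟨a, b, rfl, ha, rfl⟩ := List.map_eq_append_iff.1 he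
      exact ⟨b, hf.list_map ha ▸ hz, rfl⟩
  · refine Or.inl (Language.ext fun y => ?_)
    rw [mem_leftQuotient, mem_map_iff]
    refine ⟨fun ⟨z, _, he⟩ => ?_, fun h => h.elim⟩
    obtain ⟨a, b, rfl, ha, rfl⟩ := List.map_eq_append_iff.1 he
    exact (hx ⟨a, ha⟩).elim

/-! ### Unambiguous operations on languages -/

/-- The product `X * Y` is unambiguous: a word has at most one factorization. -/
def UnambMul (X Y : Language α) : Prop :=
  ∀ ⦃x x' y y' : List α⦄, x ∈ X → x' ∈ X → y ∈ Y → y' ∈ Y → x ++ y = x' ++ y' → x = x' ∧ y = y'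

/-- The star of `X` is unambiguous (`X` is a code): the products `X * X ^ n` are unambiguous and the
powers of `X` are disjoint. -/
def UnambStar (X : Language α) : Prop :=
  (∀ n, UnambMul X (X ^ n)) ∧ ∀ x n k, x ∈ X ^ n → x ∈ X ^ k → n = k

/-- No word of `X` is a proper prefix of another one. -/
def PrefixFree (X : Language α) : Prop :=
  ∀ ⦃x y : List α⦄, x ∈ X → x ++ y ∈ X → y = []

theorem PrefixFree.append_inj {X : Language α} (hX : X.PrefixFree) {x x' y y' : List α}
    (hx : x ∈ X) (hx' : x' ∈ X) (he : x ++ y = x' ++ y') : x = x' ∧ y = y' := by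
  rcases List.append_eq_append_iff.1 he with ⟨c, rfl, rfl⟩ | ⟨c, rfl, rfl⟩
  · simp [hX hx hx']
  · simp [hX hx' hx]

theorem PrefixFree.unambMul {X : Language α} (hX : X.PrefixFree) (Y : Language α) :
    UnambMul X Y :=
  fun _ _ _ _ hx hx' _ _ he => hX.append_inj hx hx' he

/-- Prefix-free languages without the empty word are codes, since words are decoded from left to
right. -/
theorem PrefixFree.unambStar {X : Language α} (hX : X.PrefixFree) (hnil : [] ∉ X) :
    UnambStar X := by
  refine ⟨fun n => hX.unambMul _, fun x n => ?_⟩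
  have hne : ∀ k, [] ∉ X ^ (k + 1) := fun k h => by
    rw [pow_succ'] at h
    obtain ⟨u, hu, v, -, he⟩ := h
    exact hnil ((List.append_eq_nil_iff.1 he).1 ▸ hu)
  induction n generalizing x with
  | zero =>
    rintro (_ | k) hx hx'
    · rfl
    · exact (hne k ((mem_one x).1 hx ▸ hx')).elim
  | succ n ih =>
    rintro (_ | k) hx hx'
    · exact (hne n ((mem_one x).1 hx' ▸ hx)).elim
    · rw [pow_succ'] at hx hx'
      obtain ⟨u, hu, v, hv, rfl⟩ := hx
      obtain ⟨u', hu', v', hv', he⟩ := hx'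
      obtain ⟨rfl, rfl⟩ := hX.append_inj hu' hu he
      rw [ih v' k hv hv']

/-- Languages denoted by unambiguous rational expressions: all unions are disjoint, and all products
and stars are unambiguous. -/
inductive UnambRat : Language α → Prop
  | zero : UnambRat 0
  | one : UnambRat 1
  | letter (a : α) : UnambRat {[a]}
  | add {X Y : Language α} : UnambRat X → UnambRat Y → (∀ x ∈ X, x ∉ Y) → UnambRat (X + Y)
  | mul {X Y : Language α} : UnambRat X → UnambRat Y → UnambMul X Y → UnambRat (X * Y)
  | star {X : Language α} : UnambRat X → UnambStar X → UnambRat X∗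

theorem UnambRat.biUnion {ι : Type v} {P : ι → Language α} (hP : ∀ i, UnambRat (P i))
    (hdis : ∀ x i j, x ∈ P i → x ∈ P j → i = j) {S : Set ι} (hS : S.Finite) :
    UnambRat (⨆ i ∈ S, P i) := by
  induction S, hS using Set.Finite.induction_on with
  | empty =>
    simp only [Set.mem_empty_iff_false, not_false_eq_true, iSup_neg, iSup_bot]
    exact UnambRat.zero
  | @insert i S hi _ ih =>
    rw [iSup_insert]
    refine UnambRat.add (hP i) ih fun x hx h => ?_
    simp only [mem_iSup] at h
    obtain ⟨j, hj, hxj⟩ := h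
    exact hi (hdis x i j hx hxj ▸ hj)

theorem UnambRat.isRegular {X : Language α} (hX : UnambRat X) : X.IsRegular := by
  induction hX with
  | zero => exact isRegular_zero
  | one => exact isRegular_one
  | letter a => exact isRegular_letter a
  | add _ _ _ hX hY => exact hX.add hY
  | mul _ _ _ hX hY => exact hX.mul hY
  | star _ _ hX => exact hX.kstar

end Language

/-! ### Regular languages are unambiguously rational -/

namespace Language

variable {α : Type}

/-- The factors in `C` are read off from left to right; the word of `D` is recognized because no
word of `C` is a proper prefix of it. -/
theorem UnambMul.kstar_left {C D : Language α} (hC : C.PrefixFree) (hD : [] ∉ D)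
    (hCD : ∀ ⦃x y⦄, x ∈ C → x ++ y ∈ D → y = []) : UnambMul C∗ D := by
  have key : ∀ (L L' : List (List α)) (d d' : List α), (∀ z ∈ L, z ∈ C) → (∀ z ∈ L', z ∈ C) →
      d ∈ D → d' ∈ D → L.flatten ++ d = L'.flatten ++ d' → L.flatten = L'.flatten ∧ d = d' := by
    intro L
    induction L with
    | nil =>
      rintro (_ | ⟨c, L'⟩) d d' - hL' hd hd' he
      · exact ⟨rfl, he⟩
      · rw [List.flatten_nil, List.nil_append, List.flatten_cons, List.append_assoc] at he
        have := hCD (hL' c List.mem_cons_self) (he ▸ hd)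
        exact (hD ((List.append_eq_nil_iff.1 this).2 ▸ hd')).elim
    | cons c L ih =>
      rintro (_ | ⟨c', L'⟩) d d' hL hL' hd hd' he
      · rw [List.flatten_nil, List.nil_append, List.flatten_cons, List.append_assoc] at he
        have := hCD (hL c List.mem_cons_self) (he ▸ hd')
        exact (hD ((List.append_eq_nil_iff.1 this).2 ▸ hd)).elim
      · simp only [List.flatten_cons, List.append_assoc] at he ⊢
        obtain ⟨rfl, he'⟩ := hC.append_inj (hL c List.mem_cons_self) (hL' c' List.mem_cons_self) he
        obtain ⟨h1, h2⟩ := ih L' d d' (fun z hz => hL z (List.mem_cons_of_mem _ hz))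
          (fun z hz => hL' z (List.mem_cons_of_mem _ hz)) hd hd' he'
        exact ⟨by rw [h1], h2⟩
  rintro _ _ d d' ⟨L, rfl, hL⟩ ⟨L', rfl, hL'⟩ hd hd' he
  exact key L L' d d' hL hL' hd hd' he

end Language

namespace DFA

open Language

variable {α : Type} {σ : Type v} (M : DFA α σ)

/-- `M.Via S p q x`: the nonempty word `x` leads from the state `p` to the state `q`, and all states
that are visited strictly in between belong to `S`. -/
inductive Via (S : Set σ) (q : σ) : σ → List α → Prop
  | single {p : σ} {a : α} : M.step p a = q → Via S q p [a]
  | cons {p : σ} {a : α} {x : List α} : M.step p a ∈ S → Via S q (M.step p a) x → Via S q p (a :: x)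

variable {M}

theorem Via.ne_nil {S : Set σ} {p q : σ} {x : List α} (h : M.Via S q p x) : x ≠ [] := by
  cases h <;> simp

theorem Via.evalFrom {S : Set σ} {p q : σ} {x : List α} (h : M.Via S q p x) :
    M.evalFrom p x = q := by
  induction h with
  | single h => simpa using h
  | cons _ _ ih => simpa using ih

theorem Via.mono {S S' : Set σ} (hS : S ⊆ S') {p q : σ} {x : List α} (h : M.Via S q p x) :
    M.Via S' q p x := by
  induction h with
  | single h => exact .single h
  | cons h _ ih => exact .cons (hS h) ih

theorem Via.append {S : Set σ} {p q r : σ} {x y : List α} (h : M.Via S r p x) (hr : r ∈ S)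
    (h' : M.Via S q r y) : M.Via S q p (x ++ y) := by
  induction h with
  | single h => exact .cons (h ▸ hr) (h ▸ h')
  | cons h _ ih => exact .cons h ih

/-- The state reached after a proper nonempty prefix is an intermediate one. -/
theorem Via.evalFrom_mem {S : Set σ} {p q : σ} {x y : List α} (h : M.Via S q p (x ++ y))
    (hx : x ≠ []) (hy : y ≠ []) : M.evalFrom p x ∈ S := by
  induction x generalizing p with
  | nil => exact (hx rfl).elim
  | cons a x ih =>
    rw [DFA.evalFrom_cons]
    rw [List.cons_append] at h
    rcases x with _ | ⟨b, x⟩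
    · cases h with
      | single => exact (hy rfl).elim
      | cons h _ => simpa using h
    · cases h with
      | cons _ h => exact ih h (by simp)

theorem via_univ_iff {p q : σ} {x : List α} :
    M.Via Set.univ q p x ↔ x ≠ [] ∧ M.evalFrom p x = q := by
  refine ⟨fun h => ⟨h.ne_nil, h.evalFrom⟩, fun h => ?_⟩
  obtain ⟨hx, he⟩ := h
  induction x generalizing p with
  | nil => exact (hx rfl).elim
  | cons a x ih =>
    rcases x with _ | ⟨b, x⟩
    · exact .single (by simpa using he)
    · exact .cons trivial (ih (by simp) (by simpa using he))

variable (M) in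
/-- The language of the words that lead from `p` to `q` through states of `S`. -/
def viaLang (S : Set σ) (p q : σ) : Language α :=
  {x | M.Via S q p x}

theorem mem_viaLang {S : Set σ} {p q : σ} {x : List α} : x ∈ M.viaLang S p q ↔ M.Via S q p x :=
  Iff.rfl

/-- A word leading to a state `r` outside `S` is not a proper prefix of a word that passes through
`S` only. This makes all products in `viaLang_insert` unambiguous. -/
theorem eq_nil_of_append_mem_viaLang {S : Set σ} {p q r : σ} (hr : r ∉ S) ⦃x y : List α⦄
    (hx : x ∈ M.viaLang S p r) (hxy : x ++ y ∈ M.viaLang S p q) : y = [] := by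
  by_contra hy
  exact hr (Via.evalFrom hx ▸ Via.evalFrom_mem hxy (Via.ne_nil hx) hy)

theorem kstar_viaLang_append {S : Set σ} {q r : σ} {x y : List α}
    (hx : x ∈ (M.viaLang S r r)∗) (hy : y ∈ M.viaLang S r q) :
    M.Via (insert r S) q r (x ++ y) := by
  obtain ⟨L, rfl, hL⟩ := hx
  induction L with
  | nil => exact Via.mono (Set.subset_insert r S) hy
  | cons l L ih =>
    rw [List.flatten_cons, List.append_assoc]
    exact (Via.mono (Set.subset_insert r S) (hL l List.mem_cons_self)).append (Set.mem_insert r S)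
      (ih fun z hz => hL z (List.mem_cons_of_mem _ hz))

/-- The recursion formula of McNaughton and Yamada: a path either avoids the state `r`, or it is cut
at its visits to `r`. -/
theorem viaLang_insert (S : Set σ) (p q r : σ) :
    M.viaLang (insert r S) p q =
      M.viaLang S p q + M.viaLang S p r * ((M.viaLang S r r)∗ * M.viaLang S r q) := by
  ext x
  rw [mem_add]
  constructor
  · intro h
    rw [mem_viaLang] at h
    induction h with
    | single h => exact Or.inl (.single h)
    | @cons p a x hs _ ih =>
      rcases hs with hs | hs
      · -- the first letter leads to `r`: a new factor of the star, or the last factor, begins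
        refine Or.inr ?_
        rw [hs] at ih
        refine append_mem_mul (a := [a]) (.single hs) ?_
        rw [← one_add_self_mul_kstar_eq_kstar, add_mul, one_mul, mul_assoc]
        exact ih
      · rcases ih with ih | ⟨u, hu, y, hy, rfl⟩
        · exact Or.inl (.cons hs ih)
        · exact Or.inr (append_mem_mul (a := a :: u) (.cons hs hu) hy)
  · rintro (h | ⟨u, hu, _, ⟨y, hy, z, hz, rfl⟩, rfl⟩)
    · exact Via.mono (Set.subset_insert r S) h
    · exact (Via.mono (Set.subset_insert r S) hu).append (Set.mem_insert r S)
        (kstar_viaLang_append hy hz)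

theorem unambRat_viaLang [Finite α] {S : Set σ} (hS : S.Finite) (p q : σ) :
    UnambRat (M.viaLang S p q) := by
  induction S, hS using Set.Finite.induction_on generalizing p q with
  | empty =>
    have h : M.viaLang ∅ p q = ⨆ a ∈ {a | M.step p a = q}, ({[a]} : Language α) := by
      ext x
      simp only [mem_iSup, exists_prop, mem_viaLang]
      constructor
      · rintro (h | h)
        exacts [⟨_, h, rfl⟩, h.elim]
      · rintro ⟨a, ha, rfl⟩
        exact .single ha
    rw [h]
    refine UnambRat.biUnion UnambRat.letter (fun x a b ha hb => ?_) (Set.toFinite _)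
    have : [a] = [b] := Eq.trans (Eq.symm ha) hb
    simpa using this
  | @insert r S hr _ ih =>
    have hCD : ∀ q, UnambMul (M.viaLang S r r)∗ (M.viaLang S r q) := fun q =>
      UnambMul.kstar_left (eq_nil_of_append_mem_viaLang hr) (fun h => Via.ne_nil h rfl)
        (eq_nil_of_append_mem_viaLang hr)
    have hpf : ∀ p, (M.viaLang S p r).PrefixFree := fun p => eq_nil_of_append_mem_viaLang hr
    rw [viaLang_insert]
    refine .add (ih p q) (.mul (ih p r) (.mul (.star (ih r r) ?_) (ih r q) (hCD q)) ?_) ?_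
    · exact (hpf r).unambStar fun h => Via.ne_nil h rfl
    · exact (hpf p).unambMul _
    · -- a path that visits `r` is not one that avoids it
      rintro x hx ⟨u, hu, y, ⟨z, -, t, ht, hzt⟩, rfl⟩
      have hy : y = [] := eq_nil_of_append_mem_viaLang hr hu hx
      exact Via.ne_nil ht (List.append_eq_nil_iff.1 (hzt.trans hy)).2

theorem unambRat_accepts [Finite α] [Finite σ] : UnambRat M.accepts := by
  classical
  have h : UnambRat (⨆ q ∈ M.accept, M.viaLang Set.univ M.start q) :=
    UnambRat.biUnion (fun q => unambRat_viaLang Set.finite_univ _ q)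
      (fun x p q hp hq => (Via.evalFrom hp).symm.trans (Via.evalFrom hq)) (Set.toFinite _)
  have hm : ∀ x, x ∈ (⨆ q ∈ M.accept, M.viaLang Set.univ M.start q) ↔
      x ≠ [] ∧ x ∈ M.accepts := fun x => by
    simp only [mem_iSup, exists_prop, mem_viaLang, via_univ_iff, mem_accepts, DFA.eval]
    exact ⟨fun ⟨q, hq, hx, he⟩ => ⟨hx, he ▸ hq⟩, fun ⟨hx, hq⟩ => ⟨_, hq, hx, rfl⟩⟩
  by_cases hs : [] ∈ M.accepts
  · convert UnambRat.add .one h fun x hx hx' => ((hm x).1 hx').1 hx using 1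
    ext x
    rw [mem_add, hm, mem_one]
    refine ⟨fun hx => (em (x = [])).imp_right fun h => ⟨h, hx⟩, ?_⟩
    rintro (rfl | ⟨-, hx⟩)
    exacts [hs, hx]
  · convert h using 1
    ext x
    rw [hm]
    exact ⟨fun hx => ⟨fun h => hs (h ▸ hx), hx⟩, fun hx => hx.2⟩

end DFA

/-- Every regular language is denoted by an unambiguous rational expression. -/
theorem Language.IsRegular.unambRat {α : Type} [Finite α] {X : Language α} (hX : X.IsRegular) :
    UnambRat X := by
  obtain ⟨σ, _, M, rfl⟩ := hX
  exact M.unambRat_accepts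

/-! ### Sums over regular languages -/

namespace LangSum

open Language

variable {K : Type u} [Semiring K] [RationallyAdditive K] {α : Type} [Countable α] {wt : α → K}

theorem mul {X Y : Language α} (hXY : UnambMul X Y) {a b : K} (ha : LangSum wt X a)
    (hb : LangSum wt Y b) : LangSum wt (X * Y) (a * b) := by
  -- the words are sorted by their first factors
  rw [partition_iff (κ := {x // x ∈ X})
    (P := fun x => ({z | ∃ y ∈ Y, x.1 ++ y = z} : Set (List α)))
    (r := fun x => (x.1.map wt).prod * b)]
  · exact HasCSum.mul_right b ha
  · intro z
    rw [mem_mul]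
    exact ⟨fun ⟨x, hx, h⟩ => ⟨⟨x, hx⟩, h⟩, fun ⟨x, h⟩ => ⟨x.1, x.2, h⟩⟩
  · rintro z x x' ⟨y, hy, he⟩ ⟨y', hy', he'⟩
    exact Subtype.ext (hXY x.2 x'.2 hy hy' (he.trans he'.symm)).1
  · intro x
    have h := HasCSum.mul_left (x.1.map wt).prod hb
    refine (HasCSum.comp_iff (fun y : {y // y ∈ Y} => (⟨x.1 ++ y.1, y.1, y.2, rfl⟩ :
      {z // z ∈ ({z | ∃ y ∈ Y, x.1 ++ y = z} : Set (List α))})) ?_ ?_).1 ?_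
    · exact fun y y' h => Subtype.ext (List.append_cancel_left (congrArg Subtype.val h))
    · rintro ⟨_, y, hy, rfl⟩ -
      exact ⟨⟨y, hy⟩, rfl⟩
    · simpa using h

theorem pow {X : Language α} (hX : UnambStar X) {a : K} (ha : LangSum wt X a) (n : ℕ) :
    LangSum wt (X ^ n) (a ^ n) := by
  induction n with
  | zero => simpa using singleton (wt := wt) (X := 1) [] fun x => mem_one x
  | succ n ih =>
    rw [pow_succ', pow_succ']
    exact mul (hX.1 n) ha ih

/-- An unambiguous rational expression is evaluated in `K`; its stars become geometric series. -/
theorem exists_of_unambRat {X : Language α} (hX : UnambRat X) : ∃ a, LangSum wt X a := by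
  induction hX with
  | zero => exact ⟨_, zero⟩
  | one => exact ⟨_, singleton [] mem_one⟩
  | letter a => exact ⟨_, singleton [a] fun _ => Iff.rfl⟩
  | add _ _ h hX hY =>
    obtain ⟨a, ha⟩ := hX
    obtain ⟨b, hb⟩ := hY
    exact ⟨_, add h ha hb⟩
  | mul _ _ h hX hY =>
    obtain ⟨a, ha⟩ := hX
    obtain ⟨b, hb⟩ := hY
    exact ⟨_, mul h ha hb⟩
  | @star X _ h hX =>
    obtain ⟨a, ha⟩ := hX
    refine ⟨(RationallyAdditive.csum fun n : ℕ => a ^ n).get (RationallyAdditive.geom_exists a), ?_⟩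
    rw [partition_iff (P := fun n => X ^ n) (r := fun n => a ^ n), hasCSum_iff]
    · exact Part.get_mem _
    · intro x
      rw [kstar_eq_iSup_pow, mem_iSup]
    · exact h.2
    · exact pow h ha

/-- Sums over regular languages exist, whatever the weights of the letters. -/
theorem exists_of_isRegular [Finite α] {X : Language α} (hX : X.IsRegular) : ∃ a, LangSum wt X a :=
  exists_of_unambRat hX.unambRat

end LangSum

/-! ### Words with a given label -/

namespace Language

variable {α : Type} {M : Type v} [Monoid M]

/-- The words of `X` whose label, the product of the labels of the letters, is `m`. -/
def labelled (lab : α → M) (X : Language α) (m : M) : Language α :=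
  {x | x ∈ X ∧ (x.map lab).prod = m}

theorem mem_labelled {lab : α → M} {X : Language α} {m : M} {x : List α} :
    x ∈ labelled lab X m ↔ x ∈ X ∧ (x.map lab).prod = m :=
  Iff.rfl

theorem IsRegular.labelled [Finite α] (hM : IsPreRational M) {X : Language α} (hX : X.IsRegular)
    (lab : α → M) (m : M) : (labelled lab X m).IsRegular := by
  have h := hX.inf (hM α (FreeMonoid.lift lab) m)
  refine (congrArg Language.IsRegular (Language.ext fun x => ?_)).mp h
  change x ∈ X ∧ FreeMonoid.lift lab (FreeMonoid.ofList x) = m ↔ _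
  rw [FreeMonoid.lift_ofList, mem_labelled]

theorem mem_labelled_mul_iff {lab : α → M} {X Y : Language α} {m : M} {x : List α} :
    x ∈ labelled lab (X * Y) m ↔
      ∃ q : {q : M × M // q.1 * q.2 = m}, x ∈ labelled lab X q.1.1 * labelled lab Y q.1.2 := by
  constructor
  · rintro ⟨⟨u, hu, v, hv, rfl⟩, hm⟩
    exact ⟨⟨((u.map lab).prod, (v.map lab).prod), by simpa using hm⟩,
      append_mem_mul ⟨hu, rfl⟩ ⟨hv, rfl⟩⟩
  · rintro ⟨⟨q, hq⟩, u, ⟨hu, hu'⟩, v, ⟨hv, hv'⟩, rfl⟩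
    exact ⟨append_mem_mul hu hv, by simpa [hu', hv'] using hq⟩

theorem UnambMul.eq_of_mem_labelled {lab : α → M} {X Y : Language α} (h : UnambMul X Y) {m : M}
    (x : List α) (q q' : {q : M × M // q.1 * q.2 = m})
    (hq : x ∈ labelled lab X q.1.1 * labelled lab Y q.1.2)
    (hq' : x ∈ labelled lab X q'.1.1 * labelled lab Y q'.1.2) : q = q' := by
  obtain ⟨u, ⟨hu, hum⟩, v, ⟨hv, hvm⟩, rfl⟩ := hq
  obtain ⟨u', ⟨hu', hum'⟩, v', ⟨hv', hvm'⟩, he⟩ := hq'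
  obtain ⟨rfl, rfl⟩ := h hu' hu hv' hv he
  exact Subtype.ext (Prod.ext (hum.symm.trans hum') (hvm.symm.trans hvm'))

theorem UnambMul.labelled {lab : α → M} {X Y : Language α} (h : UnambMul X Y) (m n : M) :
    UnambMul (labelled lab X m) (labelled lab Y n) :=
  fun _ _ _ _ hx hx' hy hy' he => h hx.1 hx'.1 hy.1 hy'.1 he

theorem labelled_one_self (lab : α → M) : labelled lab 1 1 = 1 := by
  ext x
  rw [mem_labelled, mem_one]
  exact ⟨fun h => h.1, fun h => ⟨h, by simp [h]⟩⟩

theorem labelled_one_of_ne (lab : α → M) {m : M} (hm : m ≠ 1) : labelled lab 1 m = 0 := by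
  ext x
  rw [mem_labelled, mem_one]
  exact ⟨fun ⟨h, h'⟩ => hm (by simp [← h', h]), fun h => h.elim⟩

theorem labelled_letter_self (lab : α → M) (a : α) : labelled lab {[a]} (lab a) = {[a]} := by
  ext x
  rw [mem_labelled]
  refine ⟨fun h => h.1, fun h => ⟨h, ?_⟩⟩
  rw [show x = [a] from h]
  simp

theorem labelled_letter_of_ne (lab : α → M) {a : α} {m : M} (hm : m ≠ lab a) :
    labelled lab {[a]} m = 0 := by
  ext x
  rw [mem_labelled]
  refine ⟨fun ⟨h, h'⟩ => hm ?_, fun h => h.elim⟩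
  rw [show x = [a] from h] at h'
  simpa using h'.symm

theorem encard_mul {X Y : Language α} (h : UnambMul X Y) :
    Set.encard {x | x ∈ X * Y} = Set.encard {x | x ∈ X} * Set.encard {x | x ∈ Y} := by
  rw [← Set.encard_prod, ← Set.InjOn.encard_image (f := fun p : List α × List α => p.1 ++ p.2)]
  · congr 1
    ext x
    simp only [Set.mem_ofPred_eq, mem_mul, Set.mem_image, Set.mem_prod, Prod.exists]
    exact ⟨fun ⟨a, ha, b, hb, e⟩ => ⟨a, b, ⟨ha, hb⟩, e⟩, fun ⟨a, b, ⟨ha, hb⟩, e⟩ => ⟨a, ha, b, hb, e⟩⟩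
  · rintro ⟨a, b⟩ ⟨ha, hb⟩ ⟨a', b'⟩ ⟨ha', hb'⟩ he
    obtain ⟨rfl, rfl⟩ := h ha ha' hb hb' he
    rfl

end Language

/-! ### Expressions that represent languages -/

namespace WExpr

open Language

variable {K : Type u} [Semiring K] [RationallyAdditive K] {M : Type v} [Monoid M] {α : Type}
  {lab : α → M} {wt : α → K}

/-- The expression `W` represents the language `X` over an alphabet of labelled and weighted
letters: the ambiguity of `W` at `m` is the number of words of `X` with label `m`, and the semantics
of `W` at `m` is the sum of the weights of these words (one is defined if and only if the other
is). -/
structure Represents (lab : α → M) (wt : α → K) (W : WExpr K M) (X : Language α) : Prop where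
  amb_eq : ∀ m, W.amb m = Set.encard {x | x ∈ labelled lab X m}
  hasSem_iff : ∀ s, W.HasSem s ↔ ∀ m, LangSum wt (labelled lab X m) (s m)

/-- The sum of the weights of the words of `X` with label `m` exists for every `m`. -/
def HasLabelSums (lab : α → M) (wt : α → K) (X : Language α) : Prop :=
  ∀ m, ∃ a, LangSum wt (labelled lab X m) a

theorem hasLabelSums_of_isRegular [Finite α] (hM : IsPreRational M) {X : Language α}
    (hX : X.IsRegular) : HasLabelSums lab wt X :=
  fun m => LangSum.exists_of_isRegular (hX.labelled hM lab m)

/-- A semantics that is given by a formula, and that gives the sums over a language, is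
characterized by these sums. -/
theorem eq_iff_forall_langSum {X : Language α} {f s : M → K}
    (hf : ∀ m, LangSum wt (labelled lab X m) (f m)) :
    s = f ↔ ∀ m, LangSum wt (labelled lab X m) (s m) :=
  ⟨fun h => h ▸ hf, fun h => funext fun m => (h m).unique (hf m)⟩

open Classical in
theorem langSum_one (m : M) :
    LangSum wt (labelled lab 1 m) (if m = 1 then 1 else 0) := by
  split_ifs with h
  · rw [h, labelled_one_self]
    simpa using LangSum.singleton (wt := wt) (X := 1) [] mem_one
  · rw [labelled_one_of_ne lab h]
    exact LangSum.zero

open Classical in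
theorem encard_labelled_one (m : M) :
    Set.encard {x | x ∈ labelled lab 1 m} = if m = 1 then 1 else 0 := by
  split_ifs with h
  · rw [h, labelled_one_self]
    exact Set.encard_singleton _
  · rw [labelled_one_of_ne lab h]
    exact Set.encard_empty

open Classical in
theorem langSum_letter (a : α) (m : M) :
    LangSum wt (labelled lab {[a]} m) (if m = lab a then wt a else 0) := by
  split_ifs with h
  · rw [h, labelled_letter_self]
    simpa using LangSum.singleton (wt := wt) (X := {[a]}) [a] fun _ => Iff.rfl
  · rw [labelled_letter_of_ne lab h]
    exact LangSum.zero

open Classical in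
theorem encard_labelled_letter (a : α) (m : M) :
    Set.encard {x | x ∈ labelled lab {[a]} m} = if m = lab a then 1 else 0 := by
  split_ifs with h
  · rw [h, labelled_letter_self]
    exact Set.encard_singleton _
  · rw [labelled_letter_of_ne lab h]
    exact Set.encard_empty

namespace Represents

theorem one : Represents lab wt (scalar 1) 1 where
  amb_eq m := (encard_labelled_one m).symm
  hasSem_iff _ := eq_iff_forall_langSum fun m => langSum_one (lab := lab) (wt := wt) m

theorem scalar_letter {a : α} (ha : lab a = 1) : Represents lab wt (scalar (wt a)) {[a]} where
  amb_eq m := by rw [encard_labelled_letter, ha]; rfl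
  hasSem_iff _ := eq_iff_forall_langSum fun m => by
    have h := langSum_letter (lab := lab) (wt := wt) a m
    rwa [ha] at h

theorem elem_letter {a : α} (ha : wt a = 1) : Represents lab wt (elem (lab a)) {[a]} where
  amb_eq m := (encard_labelled_letter a m).symm
  hasSem_iff _ := eq_iff_forall_langSum fun m => by
    simpa only [ha] using langSum_letter (lab := lab) (wt := wt) a m

theorem add [Countable α] {U V : WExpr K M} {X Y : Language α} (hU : Represents lab wt U X)
    (hV : Represents lab wt V Y) (hX : HasLabelSums lab wt X) (hY : HasLabelSums lab wt Y)
    (hXY : ∀ x ∈ X, x ∉ Y) : Represents lab wt (add U V) (X + Y) := by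
  have hlab : ∀ m, labelled lab (X + Y) m = labelled lab X m + labelled lab Y m := fun m => by
    ext x
    simp only [mem_add, mem_labelled, or_and_right]
  have hdis : ∀ m, ∀ x ∈ labelled lab X m, x ∉ labelled lab Y m :=
    fun m x hx hy => hXY x hx.1 hy.1
  refine ⟨fun m => ?_, fun s => ?_⟩
  · change U.amb m + V.amb m = _
    rw [hU.amb_eq, hV.amb_eq, hlab]
    exact (Set.encard_union_eq (Set.disjoint_left.2 (hdis m))).symm
  · constructor
    · rintro ⟨a, b, ha, hb, rfl⟩ m
      rw [hlab]
      exact LangSum.add (hdis m) ((hU.hasSem_iff a).1 ha m) ((hV.hasSem_iff b).1 hb m)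
    · intro h
      choose a ha using hX
      choose b hb using hY
      refine ⟨a, b, (hU.hasSem_iff a).2 ha, (hV.hasSem_iff b).2 hb, funext fun m => ?_⟩
      have h' := LangSum.add (hdis m) (ha m) (hb m)
      rw [← hlab] at h'
      exact (h m).unique h'

end Represents

/-- The sums over an unambiguous product are given by a Cauchy product. -/
theorem langSum_mul_iff [Countable α] {X Y : Language α} (hXY : UnambMul X Y) {a b : M → K}
    (ha : ∀ m, LangSum wt (labelled lab X m) (a m)) (hb : ∀ m, LangSum wt (labelled lab Y m) (b m))
    {m : M} {c : K} : LangSum wt (labelled lab (X * Y) m) c ↔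
      HasCSum (fun q : {q : M × M // q.1 * q.2 = m} => a q.1.1 * b q.1.2) c :=
  LangSum.partition_iff (fun _ => mem_labelled_mul_iff) hXY.eq_of_mem_labelled
    fun q => LangSum.mul (hXY.labelled _ _) (ha q.1.1) (hb q.1.2)

/-- The words of an unambiguous product are counted by a Cauchy product. -/
theorem countMul_encard {X Y : Language α} (hXY : UnambMul X Y) (m : M) :
    countMul (fun m => Set.encard {x | x ∈ labelled lab X m})
      (fun m => Set.encard {x | x ∈ labelled lab Y m}) m =
      Set.encard {x | x ∈ labelled lab (X * Y) m} := by
  unfold countMul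
  simp_rw [← encard_mul (hXY.labelled _ _)]
  exact countSum_encard (fun _ => mem_labelled_mul_iff) hXY.eq_of_mem_labelled

theorem mem_labelled_kstar_iff {X : Language α} {m : M} {x : List α} :
    x ∈ labelled lab X∗ m ↔ ∃ n, x ∈ labelled lab (X ^ n) m := by
  rw [mem_labelled, kstar_eq_iSup_pow, mem_iSup, ← exists_and_right]
  rfl

namespace Represents

theorem mul [Countable α] {U V : WExpr K M} {X Y : Language α} (hU : Represents lab wt U X)
    (hV : Represents lab wt V Y) (hX : HasLabelSums lab wt X) (hY : HasLabelSums lab wt Y)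
    (hXY : UnambMul X Y) : Represents lab wt (mul U V) (X * Y) := by
  refine ⟨fun m => ?_, fun s => ?_⟩
  · rw [← countMul_encard hXY, ← funext hU.amb_eq, ← funext hV.amb_eq]
    rfl
  · constructor
    · rintro ⟨a, b, ha, hb, h⟩ m
      exact (langSum_mul_iff hXY ((hU.hasSem_iff a).1 ha) ((hV.hasSem_iff b).1 hb)).2 (h m)
    · intro h
      choose a ha using hX
      choose b hb using hY
      exact ⟨a, b, (hU.hasSem_iff a).2 ha, (hV.hasSem_iff b).2 hb,
        fun m => (langSum_mul_iff hXY ha hb).1 (h m)⟩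

theorem star [Countable α] {U : WExpr K M} {X : Language α} (hU : Represents lab wt U X)
    (hX : ∀ n, HasLabelSums lab wt (X ^ n)) (hs : UnambStar X) :
    Represents lab wt (star U) X∗ := by
  classical
  have hpart : ∀ m x i j, x ∈ labelled lab (X ^ i) m → x ∈ labelled lab (X ^ j) m → i = j :=
    fun m x i j hi hj => hs.2 x i j hi.1 hj.1
  refine ⟨fun m => ?_, fun s => ?_⟩
  · have hpow : ∀ n : ℕ, (countMul U.amb)^[n] (fun y => if y = 1 then 1 else 0) =
        fun m => Set.encard {x | x ∈ labelled lab (X ^ n) m} := by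
      intro n
      induction n with
      | zero => exact funext fun m => (encard_labelled_one m).symm
      | succ n ih =>
        rw [Function.iterate_succ_apply', ih, funext hU.amb_eq, pow_succ']
        exact funext fun m => countMul_encard (hs.1 n) m
    rw [← countSum_encard (Z := {x | x ∈ labelled lab X∗ m})
      (P := fun n => {x | x ∈ labelled lab (X ^ n) m}) (fun _ => mem_labelled_kstar_iff) (hpart m)]
    change countSum (fun n : ℕ => (countMul U.amb)^[n] (fun y => if y = 1 then 1 else 0) m) = _
    simp_rw [hpow]
  · constructor
    · rintro ⟨a, ha, t, h0, hstep, h⟩ m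
      have ha' := (hU.hasSem_iff a).1 ha
      have ht : ∀ n m, LangSum wt (labelled lab (X ^ n) m) (t n m) := by
        intro n
        induction n with
        | zero => exact fun m => h0 ▸ langSum_one m
        | succ n ih => exact fun m => pow_succ' X n ▸ (langSum_mul_iff (hs.1 n) ha' ih).2 (hstep n m)
      exact (LangSum.partition_iff (fun _ => mem_labelled_kstar_iff) (hpart m)
        fun n => ht n m).2 (h m)
    · intro h
      choose t ht using hX
      have ha : ∀ m, LangSum wt (labelled lab X m) (t 1 m) := fun m => by
        simpa only [pow_one] using ht 1 m
      refine ⟨t 1, (hU.hasSem_iff _).2 ha, t, funext fun m => ?_, fun n m => ?_, fun m => ?_⟩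
      · exact (ht 0 m).unique (langSum_one m)
      · rw [← langSum_mul_iff (hs.1 n) ha (ht n), ← pow_succ']
        exact ht (n + 1) m
      · exact (LangSum.partition_iff (fun _ => mem_labelled_kstar_iff) (hpart m)
          fun n => ht n m).1 (h m)

/-- A representation is transported along an injection of words that preserves labels and
weights. -/
theorem image {β : Type} {lab' : β → M} {wt' : β → K} {W : WExpr K M} {X : Language α}
    {Y : Language β} (hW : Represents lab wt W X) (φ : List α → List β)
    (hφ : ∀ x ∈ X, ∀ y ∈ X, φ x = φ y → x = y) (hY : ∀ y, y ∈ Y ↔ ∃ x ∈ X, φ x = y)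
    (hl : ∀ x ∈ X, ((φ x).map lab').prod = (x.map lab).prod)
    (hw : ∀ x ∈ X, ((φ x).map wt').prod = (x.map wt).prod) : Represents lab' wt' W Y := by
  have hmem : ∀ m y, y ∈ labelled lab' Y m ↔ ∃ x ∈ labelled lab X m, φ x = y := fun m y => by
    rw [mem_labelled, hY]
    constructor
    · rintro ⟨⟨x, hx, rfl⟩, hm⟩
      exact ⟨x, ⟨hx, (hl x hx).symm.trans hm⟩, rfl⟩
    · rintro ⟨x, ⟨hx, hm⟩, rfl⟩
      exact ⟨⟨x, hx, rfl⟩, (hl x hx).trans hm⟩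
  refine ⟨fun m => ?_, fun s => (hW.hasSem_iff s).trans (forall_congr' fun m => ?_)⟩
  · have h : {y | y ∈ labelled lab' Y m} = φ '' {x | x ∈ labelled lab X m} :=
      Set.ext fun y => hmem m y
    rw [hW.amb_eq, h, Set.InjOn.encard_image]
    exact fun x hx y hy he => hφ x hx.1 y hy.1 he
  · exact (LangSum.image_iff φ (fun x hx y hy he => hφ x hx.1 y hy.1 he) (hmem m)
      fun x hx => hw x hx.1).symm

end Represents

end WExpr

namespace Language

variable {α β : Type}

theorem PrefixFree.map {X : Language α} (hX : X.PrefixFree) {f : α → β}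
    (hf : Function.Injective f) : (Language.map f X).PrefixFree := by
  rintro _ y ⟨x, hx, rfl⟩ ⟨z, hz, he⟩
  obtain ⟨a, b, rfl, ha, rfl⟩ := List.map_eq_append_iff.1 he
  rw [hf.list_map ha] at hz
  simp [hX hx hz]

/-- Appending an end marker makes a language prefix-free. -/
theorem prefixFree_map_some_mul (X : Language α) :
    (Language.map some X * {[none]}).PrefixFree := by
  have hn : ∀ x : List (Option α), x ∈ ({[none]} : Language (Option α)) → x = [none] :=
    fun _ h => h
  rintro _ y ⟨_, ⟨x, -, rfl⟩, z, hz, rfl⟩ ⟨_, ⟨x', -, rfl⟩, z', hz', he⟩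
  rw [hn z hz, hn z' hz'] at he
  by_contra hy
  -- the marker after `x` would be a letter of `x'`
  have h : none ∈ (x'.map some : List (Option α)) := by
    have h' := congrArg List.dropLast he
    simp only [List.dropLast_concat, List.dropLast_append_of_ne_nil hy] at h'
    simp [h']
  simp at h

end Language

namespace WExpr

open Language

variable {K : Type u} [Semiring K] [RationallyAdditive K] {M : Type v} [Monoid M]

/-! ### From languages to expressions -/

/-- A letter is represented by the product of its label and its weight. -/
theorem Represents.letter (hM : IsPreRational M) {α : Type} {lab : α → M} {wt : α → K} (a : α) :
    Represents lab wt (.mul (.elem (lab a)) (.scalar (wt a))) {[a]} := by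
  -- the label and the weight are first represented by two different letters
  let lab' : Bool → M := fun b => if b then lab a else 1
  let wt' : Bool → K := fun b => if b then 1 else wt a
  have hpf : ({[true]} : Language Bool).PrefixFree := by
    intro x y hx hxy
    rw [show x = [true] from hx] at hxy
    exact List.append_cancel_left (show [true] ++ y = [true] ++ [] from hxy)
  have h : Represents lab' wt' (.mul (.elem (lab a)) (.scalar (wt a)))
      ({[true]} * {[false]}) :=
    .mul (elem_letter (a := true) rfl) (scalar_letter (a := false) rfl)
      (hasLabelSums_of_isRegular hM (isRegular_letter _))
      (hasLabelSums_of_isRegular hM (isRegular_letter _)) (hpf.unambMul _)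
  have hx : ∀ x, x ∈ ({[true]} * {[false]} : Language Bool) ↔ x = [true, false] := by
    intro x
    rw [mem_mul]
    constructor
    · rintro ⟨_, rfl, _, rfl, rfl⟩
      rfl
    · rintro rfl
      exact ⟨[true], rfl, [false], rfl, rfl⟩
  refine h.image (fun _ => [a]) ?_ ?_ ?_ ?_
  · intro x hx1 y hy _
    rw [(hx x).1 hx1, (hx y).1 hy]
  · intro y
    exact ⟨fun hy => ⟨[true, false], (hx _).2 rfl, Eq.symm hy⟩, fun ⟨_, _, he⟩ => Eq.symm he⟩
  · intro x hx1
    rw [(hx x).1 hx1]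
    simp [lab']
  · intro x hx1
    rw [(hx x).1 hx1]
    simp [wt']

/-- Every nonempty language denoted by an unambiguous rational expression is represented by a
`K`-expression. The empty language is not, since no `K`-expression has ambiguity zero everywhere. -/
theorem exists_represents_of_unambRat (hM : IsPreRational M) {α : Type} [Finite α] (lab : α → M)
    (wt : α → K) {X : Language α} (hX : UnambRat X) :
    X = 0 ∨ ∃ W : WExpr K M, Represents lab wt W X := by
  induction hX with
  | zero => exact Or.inl rfl
  | one => exact Or.inr ⟨_, .one⟩
  | letter a => exact Or.inr ⟨_, .letter hM a⟩
  | @add X Y hX hY h ihX ihY =>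
    rcases ihX with rfl | ⟨U, hU⟩
    · rwa [zero_add]
    rcases ihY with rfl | ⟨V, hV⟩
    · rw [add_zero]
      exact Or.inr ⟨U, hU⟩
    exact Or.inr ⟨_, hU.add hV (hasLabelSums_of_isRegular hM hX.isRegular)
      (hasLabelSums_of_isRegular hM hY.isRegular) h⟩
  | @mul X Y hX hY h ihX ihY =>
    rcases ihX with rfl | ⟨U, hU⟩
    · exact Or.inl (zero_mul _)
    rcases ihY with rfl | ⟨V, hV⟩
    · exact Or.inl (mul_zero _)
    exact Or.inr ⟨_, hU.mul hV (hasLabelSums_of_isRegular hM hX.isRegular)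
      (hasLabelSums_of_isRegular hM hY.isRegular) h⟩
  | @star X hX h ih =>
    rcases ih with rfl | ⟨U, hU⟩
    · rw [kstar_zero]
      exact Or.inr ⟨_, .one⟩
    exact Or.inr ⟨_, hU.star (fun n => hasLabelSums_of_isRegular hM (hX.isRegular.pow n)) h⟩

/-! ### From expressions to languages -/

/-- The expression `W` represents a nonempty regular language over some finite alphabet, and this
language is prefix-free and does not contain the empty word. These two properties make its star, and
its products and unions with a language over a disjoint alphabet, unambiguous. -/
def HasRegularCode (W : WExpr K M) : Prop :=
  ∃ (α : Type) (_ : Finite α) (lab : α → M) (wt : α → K) (X : Language α),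
    X.IsRegular ∧ (∃ x, x ∈ X) ∧ X.PrefixFree ∧ [] ∉ X ∧ Represents lab wt W X

/-- An end marker with label `1` and weight `1` turns any represented language into a prefix-free one
without the empty word. -/
theorem HasRegularCode.of_represents {W : WExpr K M} {α : Type} [Finite α] {lab : α → M}
    {wt : α → K} {X : Language α} (hX : X.IsRegular) (hne : ∃ x, x ∈ X)
    (hW : Represents lab wt W X) : W.HasRegularCode := by
  refine ⟨Option α, inferInstance, fun o => o.elim 1 lab, fun o => o.elim 1 wt,
    Language.map some X * {[none]}, (hX.map (Option.some_injective α)).mul (isRegular_letter _), ?_,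
    prefixFree_map_some_mul X, ?_, hW.image (fun x => x.map some ++ [none]) ?_ ?_ ?_ ?_⟩
  · obtain ⟨x, hx⟩ := hne
    exact ⟨x.map some ++ [none], append_mem_mul ⟨x, hx, rfl⟩ rfl⟩
  · rintro ⟨u, -, v, hv, he⟩
    have h : v = [none] := hv
    rw [h] at he
    exact List.append_ne_nil_of_right_ne_nil u (List.cons_ne_nil _ _) he
  · intro x _ y _ he
    exact (Option.some_injective α).list_map (List.append_cancel_right he)
  · intro y
    constructor
    · rintro ⟨_, ⟨x, hx, rfl⟩, _, rfl, rfl⟩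
      exact ⟨x, hx, rfl⟩
    · rintro ⟨x, hx, rfl⟩
      exact append_mem_mul ⟨x, hx, rfl⟩ rfl
  · intro x _
    simp [Function.comp_def]
  · intro x _
    simp [Function.comp_def]

/-- Two representations may be taken over the same alphabet, the disjoint union of the alphabets. -/
theorem Represents.map_inl_inr {α β : Type} {lab : α → M} {wt : α → K} {lab' : β → M} {wt' : β → K}
    {U V : WExpr K M} {X : Language α} {Y : Language β} (hU : Represents lab wt U X)
    (hV : Represents lab' wt' V Y) :
    Represents (Sum.elim lab lab') (Sum.elim wt wt') U (Language.map Sum.inl X) ∧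
      Represents (Sum.elim lab lab') (Sum.elim wt wt') V (Language.map Sum.inr Y) := by
  constructor
  · refine hU.image (List.map Sum.inl) (fun x _ y _ he => Sum.inl_injective.list_map he)
      (mem_map_iff _ _) ?_ ?_ <;> exact fun x _ => by rw [List.map_map]; rfl
  · refine hV.image (List.map Sum.inr) (fun x _ y _ he => Sum.inr_injective.list_map he)
      (mem_map_iff _ _) ?_ ?_ <;> exact fun x _ => by rw [List.map_map]; rfl

theorem hasRegularCode (hM : IsPreRational M) (W : WExpr K M) : W.HasRegularCode := by
  induction W with
  | scalar k =>
    exact .of_represents (isRegular_letter ()) ⟨_, rfl⟩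
      (Represents.scalar_letter (lab := fun _ => (1 : M)) (wt := fun _ => k) (a := ()) rfl)
  | elem m =>
    exact .of_represents (isRegular_letter ()) ⟨_, rfl⟩
      (Represents.elem_letter (lab := fun _ => m) (wt := fun _ => (1 : K)) (a := ()) rfl)
  | add U V hU hV =>
    obtain ⟨α, _, lab, wt, X, hX, ⟨x, hx⟩, -, hXn, hU⟩ := hU
    obtain ⟨β, _, lab', wt', Y, hY, -, -, hYn, hV⟩ := hV
    obtain ⟨hU, hV⟩ := hU.map_inl_inr hV
    have hX' := hX.map (f := (Sum.inl : α → α ⊕ β)) Sum.inl_injective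
    have hY' := hY.map (f := (Sum.inr : β → α ⊕ β)) Sum.inr_injective
    refine .of_represents (hX'.add hY') ⟨_, Or.inl ⟨x, hx, rfl⟩⟩
      (hU.add hV (hasLabelSums_of_isRegular hM hX') (hasLabelSums_of_isRegular hM hY') ?_)
    rintro _ ⟨_ | ⟨a, x⟩, hx, rfl⟩ ⟨_ | ⟨b, y⟩, hy, he⟩
    · exact hXn hx
    · simp at he
    · simp at he
    · simp at he
  | mul U V hU hV =>
    obtain ⟨α, _, lab, wt, X, hX, ⟨x, hx⟩, hXp, -, hU⟩ := hU
    obtain ⟨β, _, lab', wt', Y, hY, ⟨y, hy⟩, -, -, hV⟩ := hV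
    obtain ⟨hU, hV⟩ := hU.map_inl_inr hV
    have hX' := hX.map (f := (Sum.inl : α → α ⊕ β)) Sum.inl_injective
    have hY' := hY.map (f := (Sum.inr : β → α ⊕ β)) Sum.inr_injective
    exact .of_represents (hX'.mul hY') ⟨_, append_mem_mul ⟨x, hx, rfl⟩ ⟨y, hy, rfl⟩⟩
      (hU.mul hV (hasLabelSums_of_isRegular hM hX') (hasLabelSums_of_isRegular hM hY')
        ((hXp.map Sum.inl_injective).unambMul _))
  | star U hU =>
    obtain ⟨α, _, lab, wt, X, hX, -, hXp, hXn, hU⟩ := hU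
    exact .of_represents hX.kstar ⟨[], nil_mem_kstar X⟩
      (hU.star (fun n => hasLabelSums_of_isRegular hM (hX.pow n)) (hXp.unambStar hXn))

end WExpr

/-! ### Automata and regular languages -/

namespace WAutomaton

open Language

variable {K : Type u} {M : Type v} (A : WAutomaton K M)

theorem isPath_append {p q : A.Q} {u v : List (WTransition K M A.Q)} :
    A.IsPath p (u ++ v) q ↔ ∃ r, A.IsPath p u r ∧ A.IsPath r v q := by
  induction u generalizing p with
  | nil => exact ⟨fun h => ⟨p, rfl, h⟩, fun ⟨_, h, h'⟩ => h ▸ h'⟩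
  | cons t u ih =>
    constructor
    · rintro ⟨ht, hs, h⟩
      obtain ⟨r, h1, h2⟩ := ih.1 h
      exact ⟨r, ⟨ht, hs, h1⟩, h2⟩
    · rintro ⟨r, ⟨ht, hs, h1⟩, h2⟩
      exact ⟨ht, hs, ih.2 ⟨r, h1, h2⟩⟩

theorem mem_trans_of_isPath {p q : A.Q} {u : List (WTransition K M A.Q)} (h : A.IsPath p u q) :
    ∀ t ∈ u, t ∈ A.trans := by
  induction u generalizing p with
  | nil => simp
  | cons t u ih =>
    obtain ⟨ht, -, h⟩ := h
    rintro t' (_ | ⟨_, ht'⟩)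
    exacts [ht, ih h t' ht']

/-- The accepting runs, as words over an alphabet of letters that denote transitions, form a regular
language: a left quotient is determined by the set of the states that are reached. -/
theorem isRegular_runs {α : Type} (f : α → WTransition K M A.Q) :
    Language.IsRegular ({x | x.map f ∈ A.acceptingRuns} : Set (List α)) := by
  have := A.finite_states
  refine isRegular_of_leftQuotient_mem (Set.finite_range fun S : Set A.Q =>
    ({x | ∃ p ∈ S, ∃ q ∈ A.final, A.IsPath p (x.map f) q} : Set (List α))) fun x => ?_
  refine ⟨{r | ∃ p ∈ A.init, A.IsPath p (x.map f) r}, Language.ext fun y => ?_⟩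
  change (∃ r, (∃ p ∈ A.init, A.IsPath p (x.map f) r) ∧ ∃ q ∈ A.final, A.IsPath r (y.map f) q) ↔
    ∃ p ∈ A.init, ∃ q ∈ A.final, A.IsPath p ((x ++ y).map f) q
  simp only [List.map_append, isPath_append]
  exact ⟨fun ⟨r, ⟨p, hp, h⟩, q, hq, h'⟩ => ⟨p, hp, q, hq, r, h, h'⟩,
    fun ⟨p, hp, q, hq, r, h, h'⟩ => ⟨r, ⟨p, hp, h⟩, q, hq, h'⟩⟩

/-- The map `φ` encodes the accepting runs of `A` by the words of the language `X`, preserving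
labels and weights. -/
structure IsEncoding [Monoid M] [Semiring K] {α : Type} (lab : α → M) (wt : α → K) (X : Language α)
    (φ : List α → List (WTransition K M A.Q)) : Prop where
  injOn : ∀ x ∈ X, ∀ y ∈ X, φ x = φ y → x = y
  mem_iff : ∀ w, w ∈ A.acceptingRuns ↔ ∃ x ∈ X, φ x = w
  label_eq : ∀ x ∈ X, ((φ x).map WTransition.label).prod = (x.map lab).prod
  weight_eq : ∀ x ∈ X, ((φ x).map WTransition.weight).prod = (x.map wt).prod

namespace IsEncoding

variable [Monoid M] [Semiring K] {α : Type} {lab : α → M} {wt : α → K} {X : Language α}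
  {φ : List α → List (WTransition K M A.Q)} {A}

theorem mem_acceptingRunsOn_iff (h : A.IsEncoding lab wt X φ) {m : M}
    {w : List (WTransition K M A.Q)} :
    w ∈ A.acceptingRunsOn m ↔ ∃ x ∈ labelled lab X m, φ x = w := by
  constructor
  · rintro ⟨hw, hm⟩
    obtain ⟨x, hx, rfl⟩ := (h.mem_iff w).1 hw
    exact ⟨x, ⟨hx, (h.label_eq x hx).symm.trans hm⟩, rfl⟩
  · rintro ⟨x, ⟨hx, hm⟩, rfl⟩
    exact ⟨(h.mem_iff _).2 ⟨x, hx, rfl⟩, (h.label_eq x hx).trans hm⟩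

theorem amb_eq (h : A.IsEncoding lab wt X φ) (m : M) :
    A.amb m = Set.encard {x | x ∈ labelled lab X m} := by
  have himg : A.acceptingRunsOn m = φ '' {x | x ∈ labelled lab X m} :=
    Set.ext fun _ => h.mem_acceptingRunsOn_iff
  rw [amb, himg, Set.InjOn.encard_image]
  exact fun x hx y hy he => h.injOn x hx.1 y hy.1 he

theorem hasSem_iff [RationallyAdditive K] (h : A.IsEncoding lab wt X φ) (s : M → K) :
    A.HasSem s ↔ ∀ m, LangSum wt (labelled lab X m) (s m) := by
  refine forall_congr' fun m => ?_
  rw [← HasCSum.comp_iff (fun x : {x // x ∈ labelled lab X m} =>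
    (⟨φ x.1, h.mem_acceptingRunsOn_iff.2 ⟨x.1, x.2, rfl⟩⟩ : A.acceptingRunsOn m))
    (fun x y he => Subtype.ext (h.injOn _ x.2.1 _ y.2.1 (congrArg Subtype.val he)))
    (fun w _ => by
      obtain ⟨x, hx, he⟩ := h.mem_acceptingRunsOn_iff.1 w.2
      exact ⟨⟨x, hx⟩, Subtype.ext he⟩)]
  have hfun : (fun x : {x // x ∈ labelled lab X m} => ((φ x.1).map WTransition.weight).prod) =
      fun x => (x.1.map wt).prod := funext fun x => h.weight_eq x.1 x.2.1
  rw [hfun]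
  rfl

end IsEncoding

/-- The accepting runs of every automaton are encoded by a regular language over a finite
alphabet, whose letters are the transitions. -/
theorem exists_isRegular_isEncoding [Monoid M] [Semiring K] :
    ∃ (n : ℕ) (lab : Fin n → M) (wt : Fin n → K) (X : Language (Fin n))
      (φ : List (Fin n) → List (WTransition K M A.Q)), X.IsRegular ∧ A.IsEncoding lab wt X φ := by
  have := A.finite_trans.to_subtype
  obtain ⟨n, ⟨e⟩⟩ := Finite.exists_equiv_fin A.trans
  let f : Fin n → WTransition K M A.Q := fun i => (e.symm i).1
  have hf : Function.Injective f := Subtype.val_injective.comp e.symm.injective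
  refine ⟨n, fun i => (f i).label, fun i => (f i).weight, _, List.map f, A.isRegular_runs f,
    fun x _ y _ he => hf.list_map he, fun w => ⟨fun hw => ?_, ?_⟩, ?_, ?_⟩
  · have hw' := hw
    obtain ⟨p, -, q, -, hp⟩ := hw
    have hr : w ∈ Set.range (List.map f) := by
      rw [Set.range_list_map]
      exact fun t ht => ⟨e ⟨t, A.mem_trans_of_isPath hp t ht⟩, by simp [f]⟩
    obtain ⟨x, rfl⟩ := hr
    exact ⟨x, hw', rfl⟩
  · rintro ⟨x, hx, rfl⟩
    exact hx
  · exact fun x _ => by rw [List.map_map]; rfl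
  · exact fun x _ => by rw [List.map_map]; rfl

variable {α σ : Type} (D : DFA α σ) (lab : α → M) (wt : α → K)

/-- The transition of `ofDFA` for the letter `a` in the state `p`. -/
def dfaTransition (p : σ × Option α) (a : α) : WTransition K M (σ × Option α) :=
  ⟨p, lab a, wt a, (D.step p.1 a, some a)⟩

/-- The automaton obtained from a deterministic one by giving labels and weights to the letters. Its
states remember the last letter, so that different letters yield different transitions even if they
have the same label and weight. -/
def ofDFA [Finite α] [Finite σ] : WAutomaton K M where
  Q := σ × Option α
  finite_states := inferInstance
  init := {(D.start, none)}
  trans := Set.range fun t : (σ × Option α) × α => dfaTransition D lab wt t.1 t.2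
  finite_trans := Set.finite_range _
  final := {p | p.1 ∈ D.accept}

/-- The run of `ofDFA` on a word, from a given state. -/
def dfaRun : σ × Option α → List α → List (WTransition K M (σ × Option α))
  | _, [] => []
  | p, a :: x => dfaTransition D lab wt p a :: dfaRun (D.step p.1 a, some a) x

theorem dfaRun_letters (p : σ × Option α) (x : List α) :
    (dfaRun D lab wt p x).map (fun t => t.tgt.2) = x.map some := by
  induction x generalizing p with
  | nil => rfl
  | cons a x ih => simp [dfaRun, dfaTransition, ih]

theorem dfaRun_labels (p : σ × Option α) (x : List α) :
    (dfaRun D lab wt p x).map WTransition.label = x.map lab := by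
  induction x generalizing p with
  | nil => rfl
  | cons a x ih => simp [dfaRun, dfaTransition, ih]

theorem dfaRun_weights (p : σ × Option α) (x : List α) :
    (dfaRun D lab wt p x).map WTransition.weight = x.map wt := by
  induction x generalizing p with
  | nil => rfl
  | cons a x ih => simp [dfaRun, dfaTransition, ih]

/-- The accepted paths of `ofDFA` from `p` are the runs on the words accepted from `p`. -/
theorem exists_isPath_ofDFA_iff [Finite α] [Finite σ] (p : σ × Option α) (w : List (WTransition K M (σ × Option α))) :
    (∃ q ∈ (ofDFA D lab wt).final, (ofDFA D lab wt).IsPath p w q) ↔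
      ∃ x, D.evalFrom p.1 x ∈ D.accept ∧ dfaRun D lab wt p x = w := by
  induction w generalizing p with
  | nil =>
    constructor
    · rintro ⟨q, hq, rfl⟩
      exact ⟨[], hq, rfl⟩
    · rintro ⟨_ | ⟨a, x⟩, hx, he⟩
      · exact ⟨p, hx, rfl⟩
      · exact (List.cons_ne_nil _ _ he).elim
  | cons t w ih =>
    constructor
    · rintro ⟨q, hq, ⟨⟨p', a⟩, rfl⟩, rfl, h⟩
      obtain ⟨x, hx, rfl⟩ := (ih _).1 ⟨q, hq, h⟩
      exact ⟨a :: x, hx, rfl⟩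
    · rintro ⟨_ | ⟨a, x⟩, hx, he⟩
      · exact (List.cons_ne_nil _ _ he.symm).elim
      · obtain ⟨rfl, rfl⟩ := List.cons.inj he
        obtain ⟨q, hq, h⟩ := (ih (D.step p.1 a, some a)).2 ⟨x, hx, rfl⟩
        exact ⟨q, hq, ⟨(p, a), rfl⟩, rfl, h⟩

theorem isEncoding_ofDFA [Finite α] [Finite σ] [Monoid M] [Semiring K] :
    (ofDFA D lab wt).IsEncoding lab wt D.accepts (dfaRun D lab wt (D.start, none)) where
  injOn x _ y _ he := by
    have h := congrArg (List.map fun t => t.tgt.2) he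
    rw [dfaRun_letters, dfaRun_letters] at h
    exact (Option.some_injective α).list_map h
  mem_iff w := by
    refine Iff.trans ?_ (exists_isPath_ofDFA_iff D lab wt (D.start, none) w)
    exact ⟨fun ⟨p, hp, h⟩ => (show p = (D.start, none) from hp) ▸ h, fun h => ⟨_, rfl, h⟩⟩
  label_eq x _ := congrArg List.prod (dfaRun_labels D lab wt _ x)
  weight_eq x _ := congrArg List.prod (dfaRun_weights D lab wt _ x)

end WAutomaton

/-! ### Automata and expressions -/

open Language in
theorem WAutomaton.exists_wExpr {K : Type u} [Semiring K] [RationallyAdditive K] {M : Type v}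
    [Monoid M] (hM : IsPreRational M) {s : M → K} (A : WAutomaton K M) (hA : A.HasSem s)
    (hne : A.acceptingRuns.Nonempty) :
    ∃ W : WExpr K M, W.HasSem s ∧ ∀ m, W.amb m = A.amb m := by
  obtain ⟨n, lab, wt, X, φ, hX, hφ⟩ := A.exists_isRegular_isEncoding
  rcases WExpr.exists_represents_of_unambRat hM lab wt hX.unambRat with rfl | ⟨W, hW⟩
  · obtain ⟨w, hw⟩ := hne
    obtain ⟨x, hx, -⟩ := (hφ.mem_iff w).1 hw
    exact hx.elim
  · exact ⟨W, (hW.hasSem_iff s).2 ((hφ.hasSem_iff s).1 hA),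
      fun m => (hW.amb_eq m).trans (hφ.amb_eq m).symm⟩

open Language in
theorem WExpr.exists_wAutomaton {K : Type u} [Semiring K] [RationallyAdditive K] {M : Type v}
    [Monoid M] (hM : IsPreRational M) {s : M → K} (W : WExpr K M) (hs : W.HasSem s) :
    ∃ A : WAutomaton K M, A.HasSem s ∧ A.acceptingRuns.Nonempty ∧ ∀ m, A.amb m = W.amb m := by
  obtain ⟨α, _, lab, wt, X, ⟨σ, _, D, rfl⟩, ⟨x, hx⟩, -, -, hW⟩ := W.hasRegularCode hM
  have hD := WAutomaton.isEncoding_ofDFA D lab wt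
  exact ⟨WAutomaton.ofDFA D lab wt, (hD.hasSem_iff s).2 ((hW.hasSem_iff s).1 hs),
    ⟨_, (hD.mem_iff _).2 ⟨x, hx, rfl⟩⟩, fun m => (hD.amb_eq m).trans (hW.amb_eq m).symm⟩

theorem WAutomaton.amb_eq_zero {K : Type u} {M : Type v} [Monoid M] {A : WAutomaton K M}
    (hA : ¬ A.acceptingRuns.Nonempty) (m : M) : A.amb m = 0 :=
  Set.encard_eq_zero.2 (Set.eq_empty_of_forall_notMem fun w hw => hA ⟨w, hw.1⟩)

theorem WAutomaton.eq_zero_of_hasSem {K : Type u} [Semiring K] [RationallyAdditive K] {M : Type v}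
    [Monoid M] {A : WAutomaton K M} (hA : ¬ A.acceptingRuns.Nonempty) {s : M → K}
    (hs : A.HasSem s) : s = 0 :=
  funext fun m => (hs m).unique (HasCSum.zero fun w => (hA ⟨w.1, w.2.1⟩).elim)

theorem mainTheorem4 {K : Type u} [Semiring K] [RationallyAdditive K] {M : Type v} [Monoid M]
    (hM : IsPreRational M) (s : M → K) :
    -- ambiguity `k`, as a bound at every point
    (∀ k : ℕ, 1 ≤ k →
      ((∃ A : WAutomaton K M, A.HasSem s ∧ ∀ m, A.amb m ≤ k) ↔
        ∃ W : WExpr K M, W.HasSem s ∧ ∀ m, W.amb m ≤ k)) ∧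
    -- ambiguity `k`, as the exact maximum over all points
    (∀ k : ℕ, 1 ≤ k →
      ((∃ A : WAutomaton K M, A.HasSem s ∧ (⨆ m, A.amb m) = k) ↔
        ∃ W : WExpr K M, W.HasSem s ∧ (⨆ m, W.amb m) = k)) ∧
    -- ambiguity is preserved at every point, in both directions
    (∀ A : WAutomaton K M, A.HasSem s → A.acceptingRuns.Nonempty →
      ∃ W : WExpr K M, W.HasSem s ∧ ∀ m, W.amb m = A.amb m) ∧
    (∀ W : WExpr K M, W.HasSem s →
      ∃ A : WAutomaton K M, A.HasSem s ∧ A.acceptingRuns.Nonempty ∧ ∀ m, A.amb m = W.amb m) := by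
  refine ⟨fun k hk => ⟨?_, ?_⟩, fun k hk => ⟨?_, ?_⟩, fun A hA hne => A.exists_wExpr hM hA hne,
    fun W hW => W.exists_wAutomaton hM hW⟩
  · rintro ⟨A, hA, hk'⟩
    by_cases hne : A.acceptingRuns.Nonempty
    · obtain ⟨W, hW, h⟩ := A.exists_wExpr hM hA hne
      exact ⟨W, hW, fun m => (h m).trans_le (hk' m)⟩
    · -- without accepting runs the semantics is `0`, that of an expression with ambiguity `1`
      refine ⟨.scalar 0, ?_, fun m => ?_⟩
      · rw [WAutomaton.eq_zero_of_hasSem hne hA]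
        exact funext fun m => (ite_self 0).symm
      · have h1 : (1 : ℕ∞) ≤ k := by exact_mod_cast hk
        unfold WExpr.amb
        split_ifs
        exacts [h1, zero_le]
  · rintro ⟨W, hW, hk'⟩
    obtain ⟨A, hA, -, h⟩ := W.exists_wAutomaton hM hW
    exact ⟨A, hA, fun m => (h m).trans_le (hk' m)⟩
  · rintro ⟨A, hA, hk'⟩
    have hne : A.acceptingRuns.Nonempty := by
      by_contra hne
      have h0 : (k : ℕ∞) = 0 := by
        rw [← hk', ENat.iSup_eq_zero]
        exact WAutomaton.amb_eq_zero hne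
      have : k = 0 := by exact_mod_cast h0
      lia
    obtain ⟨W, hW, h⟩ := A.exists_wExpr hM hA hne
    exact ⟨W, hW, (iSup_congr h).trans hk'⟩
  · rintro ⟨W, hW, hk'⟩
    obtain ⟨A, hA, -, h⟩ := W.exists_wAutomaton hM hW
    exact ⟨A, hA, (iSup_congr h).trans hk'⟩
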